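/- All manifolds, metrics, tensors and vector fields are smooth ($C^\infty$). Let $M=\prod_{i=1}^{k} M_i$ be a connected finite product of finite-dimensional manifolds, let $\pi_i : M\to M_i$ be the projections, and let $g$ be a pseudo-Riemannian metric on $M$ with contravariant metric $G$. Let $T$ be an orthogonal tensor on $(M,g)$, i.e. a symmetric contravariant 2-tensor field whose associated ($g$-self-adjoint) endomorphism field of $TM$ is pointwise diagonalizable over $\mathbb{R}$. Suppose that the product manifold is adapted to the eigenspaces of $T$: there are eigenfunctions $\lambda_1,\dots,\lambda_k : M\to\mathbb{R}$ of $T$ such that for every $i$ and every $p \in M$ the eigenspace $E_i(p)=\ker(T_p-\lambda_i(p) I)\neq 0$ is the tangent space at $p$ of the slice $\{p_1\}\times\dots\times\{p_{i-1}\}\times M_i\times\{p_{i+1}\}\times\dots\times\{p_k\}$ (in particular the eigenspaces are orthogonally integrable and $TM$ is the orthogonal direct sum of $E_1,\dots,E_k$). For a tangent vector $v$ let $v^{j}$ be its orthogonal projection onto $E_j$ and let $v^{\perp i}=v-v^{i}$ be its orthogonal projection onto $E_i^{\perp}$. Let $\nabla f$ denote the gradient of $f$. Then $T$ is a conformal Killing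 tensor, i.e. there is a vector field $C$ on $M$ such that the Schouten bracket of symmetric tensors satisfies $[T,G]=-2\,C\odot G$, if and only if $(M,g)$ is a twisted product with suitable twist functions, i.e. there are pseudo-Riemannian metrics $g_i$ on $M_i$ and smooth functions $\rho_i : M\to(0,\infty)$, $i=1,\dots,k$, such that $$g=\sum_{i=1}^{k}\rho_i^{2}\,\pi_i^{*}g_i$$ and, for every $i$, $$(\nabla\log\rho_i)^{\perp i}=\frac12\sum_{j\neq i}\bigl(\nabla\log|\lambda_i-\lambda_j|\bigr)^{j}.$$ -/

import Mathlib

open scoped Manifold ContDiff Bundle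
open Bundle

noncomputable section

/-! ### Pseudo-Riemannian metrics -/

section Metric

variable {E : Type*} [NormedAddCommGroup E] [NormedSpace ℝ E]
  {H : Type*} [TopologicalSpace H]

/-- A smooth pseudo-Riemannian metric on `M`: a smooth field of symmetric non-degenerate bilinear
forms on the tangent spaces. -/
structure PseudoRiemannianMetric (I : ModelWithCorners ℝ E H) (M : Type*) [TopologicalSpace M]
    [ChartedSpace H M] [IsManifold I ∞ M] where
  inner (x : M) : TangentSpace I x →L[ℝ] TangentSpace I x →L[ℝ] ℝ
  symm (x : M) (v w : TangentSpace I x) : inner x v w = inner x w v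
  nondegenerate (x : M) (v : TangentSpace I x) : (∀ w, inner x v w = 0) → v = 0
  contMDiff : ContMDiff I (I.prod 𝓘(ℝ, E →L[ℝ] E →L[ℝ] ℝ)) ∞
    (fun x ↦ TotalSpace.mk' (E →L[ℝ] E →L[ℝ] ℝ)
      (E := fun x : M ↦ TangentSpace I x →L[ℝ] TangentSpace I x →L[ℝ] ℝ) x (inner x))

variable {I : ModelWithCorners ℝ E H} {M : Type*} [TopologicalSpace M]
  [ChartedSpace H M] [IsManifold I ∞ M]

instance tangentSpace_finiteDimensional [FiniteDimensional ℝ E] (x : M) :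
    FiniteDimensional ℝ (TangentSpace I x) :=
  inferInstanceAs (FiniteDimensional ℝ E)

namespace PseudoRiemannianMetric

/-- The metric at a point as a bilinear form. -/
def form (g : PseudoRiemannianMetric I M) (x : M) : LinearMap.BilinForm ℝ (TangentSpace I x) :=
  LinearMap.mk₂ ℝ (fun v w ↦ g.inner x v w) (by simp) (by simp) (by simp) (by simp)

theorem form_nondegenerate (g : PseudoRiemannianMetric I M) (x : M) :
    (g.form x).Nondegenerate :=
  ⟨fun v hv ↦ g.nondegenerate x v hv,
    fun v hv ↦ g.nondegenerate x v fun w ↦ (g.symm x v w).trans (hv w)⟩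

variable [FiniteDimensional ℝ E]

/-- The tangent vector metrically equivalent to a covector. -/
def sharp (g : PseudoRiemannianMetric I M) (x : M) (α : TangentSpace I x →L[ℝ] ℝ) :
    TangentSpace I x :=
  ((g.form x).toDual (g.form_nondegenerate x)).symm α.toLinearMap

/-- The characteristic property of `sharp`. -/
theorem inner_sharp (g : PseudoRiemannianMetric I M) (x : M) (α : TangentSpace I x →L[ℝ] ℝ)
    (w : TangentSpace I x) : g.inner x (g.sharp x α) w = α w := by
  have h := LinearMap.BilinForm.apply_toDual_symm_apply (hB := g.form_nondegenerate x)
    α.toLinearMap w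
  exact h

/-- The gradient `∇ f`, the vector field metrically equivalent to `df`. -/
def grad (g : PseudoRiemannianMetric I M) (f : M → ℝ) (x : M) : TangentSpace I x :=
  g.sharp x (mvfderiv I f x)

/-- The contravariant form `K(α, β) = α (T β♯)` of an endomorphism field `T`. -/
def raise (g : PseudoRiemannianMetric I M)
    (T : (x : M) → TangentSpace I x →L[ℝ] TangentSpace I x) (x : M)
    (α β : TangentSpace I x →L[ℝ] ℝ) : ℝ :=
  α (T x (g.sharp x β))

/-- The contravariant metric `G(α, β) = α (β♯)`. -/
def contravariant (g : PseudoRiemannianMetric I M) (x : M)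
    (α β : TangentSpace I x →L[ℝ] ℝ) : ℝ :=
  α (g.sharp x β)

end PseudoRiemannianMetric

open Classical in
/-- The `g`-orthogonal projection of `v` onto a subspace `W` of a tangent space on which `g` is
non-degenerate (that is, one complementary to its orthogonal space); `0` by convention for other
`W`. -/
def PseudoRiemannianMetric.orthProj (g : PseudoRiemannianMetric I M) (x : M)
    (W : Submodule ℝ (TangentSpace I x)) (v : TangentSpace I x) : TangentSpace I x :=
  if h : IsCompl W ((g.form x).orthogonal W) then
    W.projection ((g.form x).orthogonal W) h v
  else 0

/-- `(v)^⊥`: the component of `v` orthogonal to `W`. -/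
def PseudoRiemannianMetric.perpProj (g : PseudoRiemannianMetric I M) (x : M)
    (W : Submodule ℝ (TangentSpace I x)) (v : TangentSpace I x) : TangentSpace I x :=
  v - g.orthProj x W v

/-! ### Orthogonal tensors and conformal Killing tensors -/

/-- The Schouten bracket `[K, L]` of symmetric contravariant 2-tensor fields, as a cubic form on
covectors, evaluated at the covector `df_x`.  Identifying a symmetric contravariant tensor with the
fibrewise polynomial `α ↦ K(α, α)` on the cotangent bundle, `[K, L]` is the Poisson bracket
`∂K/∂p_i ∂L/∂x^i - ∂L/∂p_i ∂K/∂x^i`; along the section `p = df` this is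
`2 (K(df, d(L(df, df))) - L(df, d(K(df, df))))`, the second derivatives of `f` cancelling. -/
def schoutenBracket (K L : (x : M) → (TangentSpace I x →L[ℝ] ℝ) → (TangentSpace I x →L[ℝ] ℝ) → ℝ)
    (f : M → ℝ) (x : M) : ℝ :=
  2 * (K x (mvfderiv I f x) (mvfderiv I (fun y ↦ L y (mvfderiv I f y) (mvfderiv I f y)) x)
    - L x (mvfderiv I f x) (mvfderiv I (fun y ↦ K y (mvfderiv I f y) (mvfderiv I f y)) x))

/-- An orthogonal tensor, given through its endomorphism field: smooth, with symmetric
contravariant form (i.e. `g`-self-adjoint), and pointwise diagonalizable over `ℝ`. -/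
structure IsOrthogonalTensor (g : PseudoRiemannianMetric I M)
    (T : (x : M) → TangentSpace I x →L[ℝ] TangentSpace I x) : Prop where
  contMDiff : ContMDiff I (I.prod 𝓘(ℝ, E →L[ℝ] E)) ∞
    (fun x ↦ TotalSpace.mk' (E →L[ℝ] E)
      (E := fun x : M ↦ TangentSpace I x →L[ℝ] TangentSpace I x) x (T x))
  selfAdjoint (x : M) (v w : TangentSpace I x) : g.inner x (T x v) w = g.inner x v (T x w)
  diagonalizable (x : M) : ⨆ μ : ℝ, Module.End.eigenspace (T x).toLinearMap μ = ⊤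

/-- `T` is a conformal Killing tensor: `[K, G] = -2 C ⊙ G` for some smooth vector field `C`, where
`K` is the contravariant form of `T` and `G` the contravariant metric.  Both sides are compared as
cubic forms on covectors; every covector at `x` is `df_x` for a function `f` smooth near `x`. -/
def IsConformalKilling [FiniteDimensional ℝ E] (g : PseudoRiemannianMetric I M)
    (T : (x : M) → TangentSpace I x →L[ℝ] TangentSpace I x) : Prop :=
  ∃ C : (x : M) → TangentSpace I x,
    ContMDiff I I.tangent ∞ (fun x ↦ (⟨x, C x⟩ : TangentBundle I M)) ∧
    ∀ (x : M) (f : M → ℝ), ContMDiffAt I 𝓘(ℝ, ℝ) ∞ f x →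
      schoutenBracket (I := I) (g.raise T) g.contravariant f x =
        -2 * (mvfderiv I f x (C x) * g.contravariant x (mvfderiv I f x) (mvfderiv I f x))

end Metric

/-! ### Product manifolds -/

section Product

variable {ι : Type*} [Fintype ι] {E : ι → Type*} [∀ i, NormedAddCommGroup (E i)]
  [∀ i, NormedSpace ℝ (E i)]

/-- The model of a finite product of manifolds modelled on the vector spaces `E i`. -/
abbrev piModel (E : ι → Type*) [∀ i, NormedAddCommGroup (E i)] [∀ i, NormedSpace ℝ (E i)] :
    ModelWithCorners ℝ (∀ i, E i) (ModelPi E) :=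
  ModelWithCorners.pi fun i ↦ 𝓘(ℝ, E i)

variable {M : ι → Type*} [∀ i, TopologicalSpace (M i)] [∀ i, ChartedSpace (E i) (M i)]

/-- A finite product of smooth manifolds is a smooth manifold. -/
instance isManifold_pi [∀ i, IsManifold 𝓘(ℝ, E i) ∞ (M i)] :
    IsManifold (piModel E) ∞ (∀ i, M i) := by
  apply isManifold_of_contDiffOn
  rintro _ _ ⟨e, he, rfl⟩ ⟨e', he', rfl⟩
  rw [contDiffOn_pi]
  intro i
  have hi : ContDiffOn ℝ ∞ ((e i).symm ≫ₕ e' i) ((e i).symm ≫ₕ e' i).source := by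
    have h := (HasGroupoid.compatible (G := contDiffGroupoid ∞ 𝓘(ℝ, E i))
      (he i (Set.mem_univ i)) (he' i (Set.mem_univ i))).1
    simpa [contDiffPregroupoid] using h
  refine hi.comp (ContinuousLinearMap.proj (R := ℝ) (φ := E) i).contDiff.contDiffOn ?_
  rintro x ⟨⟨hx, hx'⟩, -⟩
  exact ⟨hx i (Set.mem_univ i), hx' i (Set.mem_univ i)⟩

variable [∀ i, IsManifold 𝓘(ℝ, E i) ∞ (M i)]

/-- The distribution of the product net belonging to the `i`-th factor: at `x` it is the tangent
space of the slice `(x_1, …, x_{i-1}) × M_i × (x_{i+1}, …, x_k)`, that is, the space of the vectors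
annihilated by the derivatives of all the other projections. -/
def productNet (i : ι) (x : ∀ i, M i) : Submodule ℝ (TangentSpace (piModel E) x) :=
  ⨅ j : {j : ι // j ≠ i},
    LinearMap.ker (mfderiv (piModel E) 𝓘(ℝ, E j) (fun y : ∀ i, M i ↦ y j) x).toLinearMap

/-- The product manifold `∏ M_i` is adapted to the eigenspaces of the endomorphism field `T`, with
eigenfunctions `lam i`: at every point each `lam i` is an eigenvalue of `T`, and the slices of the
`i`-th factor are integral manifolds of the eigenspace `ker (T - lam i)`. -/
structure IsAdaptedToEigenspaces
    (T : (x : ∀ i, M i) → TangentSpace (piModel E) x →L[ℝ] TangentSpace (piModel E) x)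
    (lam : ι → (∀ i, M i) → ℝ) : Prop where
  hasEigenvalue (i : ι) (x : ∀ i, M i) :
    Module.End.HasEigenvalue (T x).toLinearMap (lam i x)
  eigenspace_eq (i : ι) (x : ∀ i, M i) :
    Module.End.eigenspace (T x).toLinearMap (lam i x) = productNet i x

/-- `g = ∑ ρ_i² π_i^* g_i` with smooth positive twist functions `ρ_i`. -/
structure IsTwistedProductMetric (g : PseudoRiemannianMetric (piModel E) (∀ i, M i))
    (gf : (i : ι) → PseudoRiemannianMetric 𝓘(ℝ, E i) (M i)) (ρ : ι → (∀ i, M i) → ℝ) :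
    Prop where
  contMDiff (i : ι) : ContMDiff (piModel E) 𝓘(ℝ, ℝ) ∞ (ρ i)
  pos (i : ι) (x : ∀ i, M i) : 0 < ρ i x
  inner_eq (x : ∀ i, M i) (v w : TangentSpace (piModel E) x) :
    g.inner x v w = ∑ i, ρ i x ^ 2 * (gf i).inner (x i)
      (mfderiv (piModel E) 𝓘(ℝ, E i) (fun y : ∀ i, M i ↦ y i) x v)
      (mfderiv (piModel E) 𝓘(ℝ, E i) (fun y : ∀ i, M i ↦ y i) x w)

end Product

end

open scoped Topology

noncomputable section

/-! ### Calculus on a finite product manifold: projections, slices, inclusions of factors. -/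

section ProductManifold

variable {ι : Type*} [Fintype ι] {E : ι → Type*} [∀ i, NormedAddCommGroup (E i)]
  [∀ i, NormedSpace ℝ (E i)]

/-! Both sides of the equivalence are reformulations of one first-order condition on the blocks of
the metric, `BlockScaling`: for `i ≠ j`, the derivative of `g_j(v, v)` along the `i`-th factor,
times `λ_i - λ_j`, equals the derivative of `λ_i - λ_j` times `g_j(v, v)`. Equivalently, `g_j / (λ_i
- λ_j)` does not change along the `i`-th factor.

Self-adjointness of `T` and distinctness of the eigenvalues make the metric block diagonal. Write `X
= ∇f` at a point. In a product chart the Hessian of `f` drops out of the bracket, since it is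
symmetric while its coefficients `λ_i - λ_j` are antisymmetric. What remains is a cubic form in `X`
built from the derivatives of `g_j` and `λ_j` (`schoutenBracket_eq`), so `T` is conformal Killing
exactly when this form equals `⟨X, C⟩⟨X, X⟩` for a smooth `C`. Vectors `X` in one block force `⟨·,
C⟩ = dλ_i` on `E_i`; the part of the equation odd in `a` for `X = a + v`, with `a` and `v` in two
different blocks, is then `BlockScaling`. Conversely, under `BlockScaling` the cubic form factors
with `C = ∑ (∇λ_i)^i` (`isConformalKilling_iff_blockScaling`).

For a twisted product, the logarithmic derivative of `g_j` along another factor is `2 d log ρ_j`, so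
`BlockScaling` is the stated condition on the twist functions
(`IsTwistedProductMetric.blockScaling_iff`). It remains to derive a twisted product from
`BlockScaling`. Integrating along the connected `i`-th factor shows that moving the `i`-th
coordinate rescales `g_j` by a ratio of values of `λ_i - λ_j`, positive because this function has no
zeros. Freezing all coordinates but the `j`-th one after another gives `g_j` as a positive function
times a metric on `M_j`, and `ρ_j` is its square root. -/

instance piModel_boundaryless : (piModel E).Boundaryless where
  range_eq_univ := by
    have : Set.range (piModel E) = Set.range (Pi.map fun i ↦ (𝓘(ℝ, E i) : E i → E i)) := rfl
    rw [this, Set.range_piMap]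
    simp

variable {M : ι → Type*} [∀ i, TopologicalSpace (M i)] [∀ i, ChartedSpace (E i) (M i)]

variable {E' H' N : Type*} [NormedAddCommGroup E'] [NormedSpace ℝ E'] [TopologicalSpace H']
  {I' : ModelWithCorners ℝ E' H'} [TopologicalSpace N] [ChartedSpace H' N]

theorem contMDiffAt_pi_iff {n : WithTop ℕ∞} {f : N → ∀ i, M i} {x : N} :
    ContMDiffAt I' (piModel E) n f x ↔
      ∀ i, ContMDiffAt I' 𝓘(ℝ, E i) n (fun y ↦ f y i) x := by
  rw [contMDiffAt_iff_target, continuousAt_pi, contMDiffAt_pi_space, ← forall_and]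
  exact forall_congr' fun i ↦
    (contMDiffAt_iff_target (I' := 𝓘(ℝ, E i)) (f := fun y ↦ f y i)).symm

theorem contMDiff_apply_pi {n : WithTop ℕ∞} (i : ι) :
    ContMDiff (piModel E) 𝓘(ℝ, E i) n (fun y : ∀ i, M i ↦ y i) :=
  fun _ ↦ contMDiffAt_pi_iff.1 contMDiffAt_id i

theorem contMDiff_pi_iff {n : WithTop ℕ∞} {f : N → ∀ i, M i} :
    ContMDiff I' (piModel E) n f ↔ ∀ i, ContMDiff I' 𝓘(ℝ, E i) n (fun y ↦ f y i) :=
  ⟨fun h i x ↦ contMDiffAt_pi_iff.1 (h x) i, fun h x ↦ contMDiffAt_pi_iff.2 fun i ↦ h i x⟩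

/-- The `i`-th component of a tangent vector of the product. -/
def tangentProj (x : ∀ i, M i) (i : ι) : TangentSpace (piModel E) x →L[ℝ] E i :=
  ContinuousLinearMap.proj (R := ℝ) (φ := E) i

theorem tangent_ext {x : ∀ i, M i} {v w : TangentSpace (piModel E) x}
    (h : ∀ i, tangentProj x i v = tangentProj x i w) : v = w :=
  funext h

/-- The product chart is taken componentwise, so near the base point the projection reads in charts
as the linear coordinate projection. -/
theorem hasMFDerivAt_apply_pi (x : ∀ i, M i) (i : ι) :
    HasMFDerivAt (piModel E) 𝓘(ℝ, E i) (fun y : ∀ i, M i ↦ y i) x (tangentProj x i) := by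
  refine ⟨(continuous_apply i).continuousAt, ?_⟩
  have h := (ContinuousLinearMap.proj (R := ℝ) (φ := E) i).hasFDerivAt
    (x := extChartAt (piModel E) x x)
  refine (h.congr_of_eventuallyEq ?_).hasFDerivWithinAt
  have h1 := (continuous_apply i (A := E)).continuousAt.preimage_mem_nhds
    (x := extChartAt (piModel E) x x) (extChartAt_target_mem_nhds (I := 𝓘(ℝ, E i)) (x i))
  filter_upwards [h1] with z hz
  exact (extChartAt 𝓘(ℝ, E i) (x i)).right_inv hz

theorem mfderiv_apply_pi (x : ∀ i, M i) (i : ι) (v : TangentSpace (piModel E) x) :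
    mfderiv (piModel E) 𝓘(ℝ, E i) (fun y : ∀ i, M i ↦ y i) x v = tangentProj x i v := by
  rw [(hasMFDerivAt_apply_pi x i).mfderiv]
  rfl

theorem tangentProj_mfderiv {f : N → ∀ i, M i} {x : N}
    (hf : MDifferentiableAt I' (piModel E) f x) (i : ι) (v : TangentSpace I' x) :
    tangentProj (f x) i (mfderiv I' (piModel E) f x v) =
      mfderiv I' 𝓘(ℝ, E i) (fun y ↦ f y i) x v := by
  have h := ((hasMFDerivAt_apply_pi (f x) i).comp x hf.hasMFDerivAt).mfderiv
  exact (congrArg (fun L ↦ L v) h).symm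

theorem mem_productNet {x : ∀ i, M i} {i : ι} {v : TangentSpace (piModel E) x} :
    v ∈ productNet i x ↔ ∀ j, j ≠ i → tangentProj x j v = 0 := by
  simp only [productNet, Submodule.mem_iInf, Subtype.forall, LinearMap.mem_ker]
  refine forall₂_congr fun j _ ↦ ?_
  rw [← mfderiv_apply_pi]
  rfl

variable [DecidableEq ι]

theorem contMDiff_update {n : WithTop ℕ∞} (x : ∀ i, M i) (i : ι) :
    ContMDiff 𝓘(ℝ, E i) (piModel E) n (fun y : M i ↦ Function.update x i y) := by
  rw [contMDiff_pi_iff]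
  intro j
  by_cases h : j = i
  · subst h; simpa using! contMDiff_id
  · simpa [Function.update_of_ne h] using contMDiff_const

theorem contMDiff_update_const {n : WithTop ℕ∞} (i : ι) (a : M i) :
    ContMDiff (piModel E) (piModel E) n (fun x : ∀ i, M i ↦ Function.update x i a) := by
  rw [contMDiff_pi_iff]
  intro j
  by_cases h : j = i
  · subst h; simpa using contMDiff_const
  · simpa [Function.update_of_ne h] using contMDiff_apply_pi j

/-- The inclusion of the `i`-th factor into the tangent space of the product. -/
def tangentSingle (x : ∀ i, M i) (i : ι) : E i →L[ℝ] TangentSpace (piModel E) x :=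
  ContinuousLinearMap.single ℝ E i

@[simp]
theorem tangentProj_tangentSingle_self (x : ∀ i, M i) (i : ι) (v : E i) :
    tangentProj x i (tangentSingle x i v) = v :=
  Pi.single_eq_same i v

theorem tangentProj_tangentSingle_of_ne (x : ∀ i, M i) {i j : ι} (h : j ≠ i) (v : E i) :
    tangentProj x j (tangentSingle x i v) = 0 :=
  Pi.single_eq_of_ne h v

theorem sum_tangentSingle (x : ∀ i, M i) (v : TangentSpace (piModel E) x) :
    ∑ i, tangentSingle x i (tangentProj x i v) = v :=
  Finset.univ_sum_single (M := E) v

theorem mfderiv_update (x : ∀ i, M i) (i : ι) (y : M i) (v : TangentSpace 𝓘(ℝ, E i) y) :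
    mfderiv 𝓘(ℝ, E i) (piModel E) (fun y : M i ↦ Function.update x i y) y v =
      tangentSingle (Function.update x i y) i v := by
  apply tangent_ext
  intro j
  rw [tangentProj_mfderiv ((contMDiff_update (n := 1) x i).mdifferentiable one_ne_zero y)]
  by_cases h : j = i
  · subst h
    have : (fun y : M j ↦ Function.update x j y j) = id := by ext; simp
    rw [this, mfderiv_id]
    exact (tangentProj_tangentSingle_self (Function.update x j y) j v).symm
  · have : (fun y : M i ↦ Function.update x i y j) = fun _ ↦ x j := by
      ext; simp [Function.update_of_ne h]
    rw [this, mfderiv_const]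
    exact (tangentProj_tangentSingle_of_ne (Function.update x i y) h v).symm

theorem tangentSingle_mem_productNet (x : ∀ i, M i) (i : ι) (v : E i) :
    tangentSingle x i v ∈ productNet i x :=
  mem_productNet.2 fun _ hj ↦ tangentProj_tangentSingle_of_ne x hj v

theorem tangentSingle_tangentProj_of_mem {x : ∀ i, M i} {i : ι} {v : TangentSpace (piModel E) x}
    (hv : v ∈ productNet i x) : tangentSingle x i (tangentProj x i v) = v := by
  apply tangent_ext
  intro j
  by_cases h : j = i
  · subst h; simp
  · rw [tangentProj_tangentSingle_of_ne _ h, mem_productNet.1 hv j h]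

end ProductManifold

/-! ### Chart frames and the passage between manifold derivatives and derivatives in a chart. -/

section ChartFrame

variable {E : Type*} [NormedAddCommGroup E] [NormedSpace ℝ E]
  {H : Type*} [TopologicalSpace H] (I : ModelWithCorners ℝ E H)
  {M : Type*} [TopologicalSpace M] [ChartedSpace H M]

variable {I} in
theorem contDiffAt_comp_extChartAt_symm [I.Boundaryless] {F : Type*} [NormedAddCommGroup F]
    [NormedSpace ℝ F] {x : M}
    {n : WithTop ℕ∞} {f : M → F} (h : ContMDiffAt I 𝓘(ℝ, F) n f x) :
    ContDiffAt ℝ n (f ∘ (extChartAt I x).symm) (extChartAt I x x) := by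
  have := (contMDiffAt_iff.1 h).2
  rw [I.range_eq_univ, contDiffWithinAt_univ] at this
  exact this

variable {I} in
theorem tendsto_extChartAt_symm [I.Boundaryless] (x : M) :
    Filter.Tendsto (extChartAt I x).symm (𝓝 (extChartAt I x x)) (𝓝 x) := by
  have := continuousAt_extChartAt_symm (I := I) x
  rwa [ContinuousAt, extChartAt_to_inv] at this

variable [IsManifold I ∞ M]

/-- The frame of the tangent bundle over the domain of the preferred chart at `x₀`. -/
def chartFrame (x₀ y : M) : E →L[ℝ] TangentSpace I y :=
  (trivializationAt E (TangentSpace I) x₀).symmL ℝ y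

/-- The coordinates of tangent vectors in `chartFrame`. -/
def chartCoframe (x₀ y : M) : TangentSpace I y →L[ℝ] E :=
  (trivializationAt E (TangentSpace I) x₀).continuousLinearMapAt ℝ y

variable {I}

theorem chartFrame_chartCoframe {x₀ y : M} (hy : y ∈ (chartAt H x₀).source)
    (v : TangentSpace I y) : chartFrame I x₀ y (chartCoframe I x₀ y v) = v :=
  (trivializationAt E (TangentSpace I) x₀).symmL_continuousLinearMapAt
    (by simpa using hy) v

theorem chartCoframe_chartFrame {x₀ y : M} (hy : y ∈ (chartAt H x₀).source) (v : E) :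
    chartCoframe I x₀ y (chartFrame I x₀ y v) = v :=
  (trivializationAt E (TangentSpace I) x₀).continuousLinearMapAt_symmL
    (by simpa using hy) v

/-- A tangent space is by definition the model space seen through the preferred chart. Hence at the
base point vectors are their own coordinates. -/
theorem chartFrame_self (x : M) (v : E) : chartFrame I x x v = v := by
  unfold chartFrame
  rw [TangentBundle.symmL_trivializationAt_eq_core (mem_chart_source H x)]
  exact (tangentBundleCore I M).coordChange_self (achart H x) x (mem_chart_source H x) v

theorem contMDiffAt_chartFrame {x₀ y : M} (hy : y ∈ (chartAt H x₀).source) (v : E) :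
    ContMDiffAt I I.tangent ∞
      (fun y ↦ (⟨y, chartFrame I x₀ y v⟩ : TangentBundle I M)) y := by
  have h := (trivializationAt E (TangentSpace I) x₀).contMDiffAt_symmL (IB := I) (n := ∞)
    (x := y) (by simpa using hy)
  exact h.clm_bundle_apply (E₁ := fun _ ↦ E) (v := fun _ ↦ v)
    ((contMDiffAt_totalSpace (E := Bundle.Trivial M E)).2 ⟨contMDiffAt_id, contMDiffAt_const⟩)

/-- The frame is the derivative of the inverse chart, so this is the chain rule. -/
theorem mvfderiv_chartFrame [I.Boundaryless] {F : Type*} [NormedAddCommGroup F]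
    [NormedSpace ℝ F] {x₀ y : M}
    (hy : y ∈ (chartAt H x₀).source) {f : M → F} (hf : MDifferentiableAt I 𝓘(ℝ, F) f y) (v : E) :
    mvfderiv I f y (chartFrame I x₀ y v) =
      fderiv ℝ (f ∘ (extChartAt I x₀).symm) (extChartAt I x₀ y) v := by
  unfold chartFrame
  rw [TangentBundle.symmL_trivializationAt hy, I.range_eq_univ, mfderivWithin_univ]
  have hs : (extChartAt I x₀).symm (extChartAt I x₀ y) = y :=
    (extChartAt I x₀).left_inv (by simpa using hy)
  have h1 : MDifferentiableAt 𝓘(ℝ, E) I (extChartAt I x₀).symm (extChartAt I x₀ y) := by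
    have := mdifferentiableWithinAt_extChartAt_symm (I := I) (x := x₀)
      (z := extChartAt I x₀ y) ((extChartAt I x₀).map_source (by simpa using hy))
    rwa [I.range_eq_univ, mdifferentiableWithinAt_univ] at this
  have h2 := mfderiv_comp_of_eq hf h1 hs
  rw [mfderiv_eq_fderiv, hs] at h2
  exact (congrArg (fun L ↦ L v) h2).symm

/-- Reduces manifold derivatives at the centre of a chart to ordinary Fréchet calculus, where the
product rules are applied. -/
theorem hasMVFDeriv_of_comp_symm [I.Boundaryless] {F : Type*} [NormedAddCommGroup F]
    [NormedSpace ℝ F] {x : M}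
    {f : M → F} {L : E →L[ℝ] F}
    (h : HasFDerivAt (f ∘ (extChartAt I x).symm) L (extChartAt I x x)) :
    MDifferentiableAt I 𝓘(ℝ, F) f x ∧ ∀ v : E, mvfderiv I f x v = L v := by
  have h1 : MDifferentiableAt I 𝓘(ℝ, F) ((f ∘ (extChartAt I x).symm) ∘ extChartAt I x) x :=
    h.differentiableAt.mdifferentiableAt.comp x
      (mdifferentiableAt_extChartAt (mem_chart_source H x))
  have h2 : MDifferentiableAt I 𝓘(ℝ, F) f x := by
    refine h1.congr_of_eventuallyEq ?_
    filter_upwards [extChartAt_source_mem_nhds (I := I) x] with y hy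
    exact congrArg f ((extChartAt I x).left_inv hy).symm
  refine ⟨h2, fun v ↦ ?_⟩
  have h3 := mvfderiv_chartFrame (mem_chart_source H x) h2 v
  rw [chartFrame_self, h.fderiv] at h3
  exact h3

/-- A field of bilinear forms in the coordinates of the preferred chart at `x₀`. -/
def bilinCoord (b : (y : M) → TangentSpace I y →L[ℝ] TangentSpace I y →L[ℝ] ℝ) (x₀ y : M) :
    E →L[ℝ] E →L[ℝ] ℝ :=
  (show E →L[ℝ] E →L[ℝ] ℝ from b y).bilinearComp
    (show E →L[ℝ] E from chartFrame I x₀ y) (show E →L[ℝ] E from chartFrame I x₀ y)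

theorem bilinCoord_apply (b : (y : M) → TangentSpace I y →L[ℝ] TangentSpace I y →L[ℝ] ℝ)
    (x₀ y : M) (v w : E) :
    bilinCoord b x₀ y v w = b y (chartFrame I x₀ y v) (chartFrame I x₀ y w) := rfl

theorem contMDiffAt_bilin_iff {b : (y : M) → TangentSpace I y →L[ℝ] TangentSpace I y →L[ℝ] ℝ}
    {x₀ : M} :
    ContMDiffAt I (I.prod 𝓘(ℝ, E →L[ℝ] E →L[ℝ] ℝ)) ∞
      (fun x ↦ TotalSpace.mk' (E →L[ℝ] E →L[ℝ] ℝ)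
        (E := fun x : M ↦ TangentSpace I x →L[ℝ] TangentSpace I x →L[ℝ] ℝ) x (b x)) x₀ ↔
      ContMDiffAt I 𝓘(ℝ, E →L[ℝ] E →L[ℝ] ℝ) ∞ (bilinCoord b x₀) x₀ := by
  rw [contMDiffAt_hom_bundle]
  refine Iff.trans (and_iff_right contMDiffAt_id) (Filter.EventuallyEq.contMDiffAt_iff ?_)
  filter_upwards [(chartAt H x₀).open_source.mem_nhds (mem_chart_source H x₀)] with y hy
  ext v w
  rw [bilinCoord_apply]
  have hb : y ∈ (trivializationAt (E →L[ℝ] ℝ)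
      (fun x : M ↦ TangentSpace I x →L[ℝ] ℝ) x₀).baseSet := by
    simp [hom_trivializationAt_baseSet, hy]
  rw [ContinuousLinearMap.inCoordinates]
  simp [chartFrame, hom_trivializationAt_apply, ContinuousLinearMap.inCoordinates,
    Trivialization.continuousLinearMapAt_apply, Trivialization.coe_linearMapAt_of_mem _ hb]

namespace PseudoRiemannianMetric

/-- The metric in the coordinates of the preferred chart at `x₀`. -/
def coord (g : PseudoRiemannianMetric I M) (x₀ y : M) : E →L[ℝ] E →L[ℝ] ℝ :=
  bilinCoord g.inner x₀ y

theorem coord_apply (g : PseudoRiemannianMetric I M) (x₀ y : M) (v w : E) :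
    g.coord x₀ y v w = g.inner y (chartFrame I x₀ y v) (chartFrame I x₀ y w) := rfl

theorem contMDiffAt_coord (g : PseudoRiemannianMetric I M) (x₀ : M) :
    ContMDiffAt I 𝓘(ℝ, E →L[ℝ] E →L[ℝ] ℝ) ∞ (g.coord x₀) x₀ :=
  contMDiffAt_bilin_iff.1 (g.contMDiff x₀)

end PseudoRiemannianMetric

end ChartFrame

/-! ### Linear equations with varying coefficients. -/

section Calculus

variable {V : Type*} [NormedAddCommGroup V] [NormedSpace ℝ V]

theorem exists_continuousLinearEquiv_of_separating [FiniteDimensional ℝ V] (B : V →L[ℝ] V →L[ℝ] ℝ)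
    (h : ∀ v, (∀ w, B v w = 0) → v = 0) :
    ∃ e : V ≃L[ℝ] (V →L[ℝ] ℝ), (e : V →L[ℝ] V →L[ℝ] ℝ) = B := by
  have hinj : Function.Injective (B : V →ₗ[ℝ] V →L[ℝ] ℝ) := by
    rw [injective_iff_map_eq_zero]
    exact fun v hv ↦ h v fun w ↦ congrArg (fun L ↦ L w) hv
  have hdim : Module.finrank ℝ V = Module.finrank ℝ (V →L[ℝ] ℝ) := by
    rw [← (LinearMap.toContinuousLinearMap : (V →ₗ[ℝ] ℝ) ≃ₗ[ℝ] V →L[ℝ] ℝ).finrank_eq]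
    exact (Subspace.dual_finrank_eq (K := ℝ) (V := V)).symm
  refine ⟨(LinearEquiv.ofInjectiveOfFinrankEq _ hinj hdim).toContinuousLinearEquiv, ?_⟩
  ext v w
  rfl

/-- The solution of a non-degenerate linear equation depends smoothly on the data. -/
theorem contMDiffAt_of_clm_apply_eq [FiniteDimensional ℝ V] {E H N : Type*} [NormedAddCommGroup E]
    [NormedSpace ℝ E] [TopologicalSpace H] {I : ModelWithCorners ℝ E H} [TopologicalSpace N]
    [ChartedSpace H N] {n : WithTop ℕ∞} {x : N} {B : N → V →L[ℝ] V →L[ℝ] ℝ} {A : N → V →L[ℝ] ℝ}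
    {X : N → V} (hB : ContMDiffAt I 𝓘(ℝ, V →L[ℝ] V →L[ℝ] ℝ) n B x)
    (hA : ContMDiffAt I 𝓘(ℝ, V →L[ℝ] ℝ) n A x) (h : ∀ v, (∀ w, B x v w = 0) → v = 0)
    (hX : ∀ᶠ y in 𝓝 x, B y (X y) = A y) : ContMDiffAt I 𝓘(ℝ, V) n X x := by
  obtain ⟨e, he⟩ := exists_continuousLinearEquiv_of_separating (B x) h
  -- Inversion is smooth at invertible operators, and these form an open set, so near `x` the
  -- solution is `B⁻¹ A`.
  have h1 : ContMDiffAt I 𝓘(ℝ, (V →L[ℝ] ℝ) →L[ℝ] V) n (fun y ↦ (B y).inverse) x := by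
    have := (contDiffAt_map_inverse (𝕜 := ℝ) (n := n) e).contMDiffAt
    rw [he] at this
    exact this.comp x hB
  refine (h1.clm_apply hA).congr_of_eventuallyEq ?_
  have h2 : ∀ᶠ L in 𝓝 (B x), ∃ e' : V ≃L[ℝ] (V →L[ℝ] ℝ), (e' : V →L[ℝ] V →L[ℝ] ℝ) = L := by
    rw [← he]
    exact e.nhds
  filter_upwards [hX, hB.continuousAt.eventually h2] with y hy ⟨e', he'⟩
  rw [← hy, ← he']
  simp

set_option synthInstance.maxHeartbeats 200000 in
-- Differentiating `B X = A` expresses `B X'` through `A'` and `B'`; symmetry of `B` and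
-- self-adjointness of `P` then eliminate `X'`. In the application `B` is the metric, `A = df`, `X`
-- the gradient and `P` the projection to one factor.
theorem hasFDerivAt_pairing {B : V → V →L[ℝ] V →L[ℝ] ℝ} {A : V → V →L[ℝ] ℝ} {X : V → V} {z : V}
    {P : V →L[ℝ] V} {B' : V →L[ℝ] V →L[ℝ] V →L[ℝ] ℝ} {A' : V →L[ℝ] V →L[ℝ] ℝ}
    (hB : HasFDerivAt B B' z) (hA : HasFDerivAt A A' z) (hX : DifferentiableAt ℝ X z)
    (hBX : ∀ᶠ y in 𝓝 z, B y (X y) = A y) (hsymm : ∀ v w, B z v w = B z w v)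
    (hP : ∀ᶠ y in 𝓝 z, ∀ v w, B y (P v) w = B y v (P w)) (hPP : ∀ v, P (P v) = P v) :
    ∃ L : V →L[ℝ] ℝ, HasFDerivAt (fun y ↦ A y (P (X y))) L z ∧
      ∀ a, L a = 2 * A' a (P (X z)) - B' a (P (X z)) (P (X z)) := by
  have hX' := hX.hasFDerivAt
  refine ⟨_, hA.clm_apply (P.hasFDerivAt.comp z hX'), fun a ↦ ?_⟩
  have h1 : B' a (X z) + B z (fderiv ℝ X z a) = A' a := by
    have := (hB.clm_apply hX').unique (hA.congr_of_eventuallyEq hBX)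
    have := congrArg (fun L ↦ L a) this
    simpa [add_comm] using this
  -- With the vectors frozen at `z`, the identity `B(PX, PX) = B(X, PX)` holds in a neighbourhood,
  -- so it may be differentiated.
  have h2 : B' a (P (X z)) (P (X z)) = B' a (X z) (P (X z)) := by
    have e1 := (hB.clm_apply (hasFDerivAt_const (P (X z)) z)).clm_apply
      (hasFDerivAt_const (P (X z)) z)
    have e2 := (hB.clm_apply (hasFDerivAt_const (X z) z)).clm_apply
      (hasFDerivAt_const (P (X z)) z)
    have e3 := e1.unique (e2.congr_of_eventuallyEq (by
      filter_upwards [hP] with y hy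
      rw [hy, hPP]))
    simpa using congrArg (fun L ↦ L a) e3
  have h3 : A z (P (fderiv ℝ X z a)) = B z (fderiv ℝ X z a) (P (X z)) := by
    rw [← hBX.self_of_nhds, ← hP.self_of_nhds, hsymm]
  have h4 := congrArg (fun L ↦ L (P (X z))) h1
  simp only [add_apply] at h4
  simp [h2, h3]
  linarith

end Calculus

/-! ### Differentials and gradients in coordinates. -/

section GradCoord

variable {E : Type*} [NormedAddCommGroup E] [NormedSpace ℝ E]
  {H : Type*} [TopologicalSpace H] {I : ModelWithCorners ℝ E H}
  {M : Type*} [TopologicalSpace M] [ChartedSpace H M] [IsManifold I ∞ M]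

/-- The differential of a function in the coordinates of the preferred chart at `x₀`. -/
def diffCoord (I : ModelWithCorners ℝ E H) [IsManifold I ∞ M] (f : M → ℝ) (x₀ y : M) : E →L[ℝ] ℝ :=
  (mvfderiv I f y).comp (chartFrame I x₀ y)

theorem diffCoord_eventuallyEq [I.Boundaryless] {f : M → ℝ} {x : M}
    (hf : ContMDiffAt I 𝓘(ℝ, ℝ) ∞ f x) :
    diffCoord I f x =ᶠ[𝓝 x]
      fderiv ℝ (f ∘ (extChartAt I x).symm) ∘ extChartAt I x := by
  -- Smoothness at a point spreads to a neighbourhood only for finite order; order one suffices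
  -- here.
  have h1 : ∀ᶠ y in 𝓝 x, ContMDiffAt I 𝓘(ℝ, ℝ) 1 f y :=
    (contMDiffAt_iff_contMDiffAt_nhds (by simp)).1 (hf.of_le (by exact_mod_cast le_top))
  filter_upwards [h1, (chartAt H x).open_source.mem_nhds (mem_chart_source H x)] with y hy hy'
  ext v
  exact mvfderiv_chartFrame hy' (hy.mdifferentiableAt one_ne_zero) v

theorem contMDiffAt_diffCoord [I.Boundaryless] {f : M → ℝ} {x : M}
    (hf : ContMDiffAt I 𝓘(ℝ, ℝ) ∞ f x) :
    ContMDiffAt I 𝓘(ℝ, E →L[ℝ] ℝ) ∞ (diffCoord I f x) x := by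
  refine ContMDiffAt.congr_of_eventuallyEq ?_ (diffCoord_eventuallyEq hf)
  exact ((contDiffAt_comp_extChartAt_symm hf).fderiv_right (m := ∞) (by simp)).contMDiffAt.comp x
    contMDiffAt_extChartAt

theorem diffCoord_comp_symm_eventuallyEq [I.Boundaryless] {f : M → ℝ} {x : M}
    (hf : ContMDiffAt I 𝓘(ℝ, ℝ) ∞ f x) :
    diffCoord I f x ∘ (extChartAt I x).symm =ᶠ[𝓝 (extChartAt I x x)]
      fderiv ℝ (f ∘ (extChartAt I x).symm) := by
  filter_upwards [(tendsto_extChartAt_symm x).eventually (diffCoord_eventuallyEq hf),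
    extChartAt_target_mem_nhds (I := I) x] with z hz hz'
  simp only [Function.comp_apply] at hz ⊢
  rw [hz, (extChartAt I x).right_inv hz']

theorem contMDiffAt_vectorField_iff {X : ∀ y : M, TangentSpace I y} {x : M} :
    ContMDiffAt I I.tangent ∞ (fun y ↦ (⟨y, X y⟩ : TangentBundle I M)) x ↔
      ContMDiffAt I 𝓘(ℝ, E) ∞ (fun y ↦ chartCoframe I x y (X y)) x := by
  rw [contMDiffAt_section]
  apply Filter.EventuallyEq.contMDiffAt_iff
  filter_upwards [(chartAt H x).open_source.mem_nhds (mem_chart_source H x)] with y hy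
  have hb : y ∈ (trivializationAt E (TangentSpace I) x).baseSet := by simpa using hy
  simp [chartCoframe, Trivialization.continuousLinearMapAt_apply,
    Trivialization.coe_linearMapAt_of_mem _ hb]

namespace PseudoRiemannianMetric

theorem coord_separating (g : PseudoRiemannianMetric I M) {x₀ y : M}
    (hy : y ∈ (chartAt H x₀).source) (v : E) (hv : ∀ w, g.coord x₀ y v w = 0) : v = 0 := by
  have h : chartFrame I x₀ y v = 0 := by
    refine g.nondegenerate y _ fun w ↦ ?_
    rw [← chartFrame_chartCoframe (I := I) hy w]
    exact hv _
  rw [← chartCoframe_chartFrame (I := I) hy v, h, map_zero]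

variable [FiniteDimensional ℝ E]

theorem inner_grad (g : PseudoRiemannianMetric I M) (f : M → ℝ) (x : M) (w : TangentSpace I x) :
    g.inner x (g.grad f x) w = mvfderiv I f x w :=
  g.inner_sharp x _ w

/-- The gradient in the coordinates of the preferred chart at `x₀`. -/
def gradCoord (g : PseudoRiemannianMetric I M) (f : M → ℝ) (x₀ y : M) : E :=
  chartCoframe I x₀ y (g.grad f y)

theorem coord_gradCoord (g : PseudoRiemannianMetric I M) (f : M → ℝ) {x₀ y : M}
    (hy : y ∈ (chartAt H x₀).source) : g.coord x₀ y (g.gradCoord f x₀ y) = diffCoord I f x₀ y := by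
  ext w
  rw [coord_apply, gradCoord, chartFrame_chartCoframe hy, inner_grad]
  rfl

theorem contMDiffAt_gradCoord [I.Boundaryless] (g : PseudoRiemannianMetric I M) {f : M → ℝ} {x : M}
    (hf : ContMDiffAt I 𝓘(ℝ, ℝ) ∞ f x) : ContMDiffAt I 𝓘(ℝ, E) ∞ (g.gradCoord f x) x := by
  refine contMDiffAt_of_clm_apply_eq (g.contMDiffAt_coord x) (contMDiffAt_diffCoord hf)
    (g.coord_separating (mem_chart_source H x)) ?_
  filter_upwards [(chartAt H x).open_source.mem_nhds (mem_chart_source H x)] with y hy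
  exact g.coord_gradCoord f hy

end PseudoRiemannianMetric

end GradCoord

/-! ### Compatibility of chart frames with the product structure. -/

section ModelProj

variable {ι : Type*} [DecidableEq ι] {E : ι → Type*} [∀ i, NormedAddCommGroup (E i)]
  [∀ i, NormedSpace ℝ (E i)]

/-- The projection of the model space onto its `j`-th factor. -/
def modelProj (E : ι → Type*) [∀ i, NormedAddCommGroup (E i)] [∀ i, NormedSpace ℝ (E i)] (j : ι) :
    (∀ i, E i) →L[ℝ] (∀ i, E i) :=
  (ContinuousLinearMap.single ℝ E j).comp (ContinuousLinearMap.proj j)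

theorem modelProj_modelProj (j : ι) (v : ∀ i, E i) :
    modelProj E j (modelProj E j v) = modelProj E j v := by
  simp [modelProj]

end ModelProj

section ProductFrame

variable {ι : Type*} [Fintype ι] {E : ι → Type*} [∀ i, NormedAddCommGroup (E i)]
  [∀ i, NormedSpace ℝ (E i)] {M : ι → Type*} [∀ i, TopologicalSpace (M i)]
  [∀ i, ChartedSpace (E i) (M i)] [∀ i, IsManifold 𝓘(ℝ, E i) ∞ (M i)]

/-- The inverse product chart acts componentwise, hence so does its derivative. -/
theorem tangentProj_chartFrame {x y : ∀ i, M i} (hy : y ∈ (chartAt (ModelPi E) x).source)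
    (j : ι) (v : ∀ i, E i) :
    tangentProj y j (chartFrame (piModel E) x y v) =
      chartFrame 𝓘(ℝ, E j) (x j) (y j) (v j) := by
  have hyj : y j ∈ (chartAt (E j) (x j)).source := by
    rw [piChartedSpace_chartAt] at hy
    exact hy j (Set.mem_univ j)
  unfold chartFrame
  rw [TangentBundle.symmL_trivializationAt hy, TangentBundle.symmL_trivializationAt hyj,
    (piModel E).range_eq_univ, (𝓘(ℝ, E j)).range_eq_univ, mfderivWithin_univ, mfderivWithin_univ]
  have hs : (extChartAt (piModel E) x).symm (extChartAt (piModel E) x y) = y :=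
    (extChartAt (piModel E) x).left_inv (by simpa using hy)
  have h1 : MDifferentiableAt 𝓘(ℝ, ∀ i, E i) (piModel E) (extChartAt (piModel E) x).symm
      (extChartAt (piModel E) x y) := by
    have := mdifferentiableWithinAt_extChartAt_symm (I := piModel E) (x := x)
      (z := extChartAt (piModel E) x y)
      ((extChartAt (piModel E) x).map_source (by simpa using hy))
    rwa [(piModel E).range_eq_univ, mdifferentiableWithinAt_univ] at this
  have h2 : MDifferentiableAt 𝓘(ℝ, E j) 𝓘(ℝ, E j) (extChartAt 𝓘(ℝ, E j) (x j)).symm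
      (extChartAt 𝓘(ℝ, E j) (x j) (y j)) := by
    have := mdifferentiableWithinAt_extChartAt_symm (I := 𝓘(ℝ, E j)) (x := x j)
      (z := extChartAt 𝓘(ℝ, E j) (x j) (y j))
      ((extChartAt 𝓘(ℝ, E j) (x j)).map_source (by simpa using hyj))
    rwa [(𝓘(ℝ, E j)).range_eq_univ, mdifferentiableWithinAt_univ] at this
  have h3 := tangentProj_mfderiv h1 j v
  have h4 := ((ContinuousLinearMap.proj (R := ℝ) (φ := E) j).hasMFDerivAt
    (x := extChartAt (piModel E) x y))
  have h5 := (HasMFDerivAt.comp (extChartAt (piModel E) x y)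
    (g := (extChartAt 𝓘(ℝ, E j) (x j)).symm) h2.hasMFDerivAt h4).mfderiv
  exact h3.trans (congrArg (fun L ↦ L v) h5)

variable [DecidableEq ι]

theorem chartFrame_single {x y : ∀ i, M i} (hy : y ∈ (chartAt (ModelPi E) x).source)
    (j : ι) (v : E j) :
    chartFrame (piModel E) x y (Pi.single j v) =
      tangentSingle y j (chartFrame 𝓘(ℝ, E j) (x j) (y j) v) := by
  apply tangent_ext
  intro k
  rw [tangentProj_chartFrame hy]
  by_cases h : k = j
  · subst h
    rw [Pi.single_eq_same]
    exact (tangentProj_tangentSingle_self y k _).symm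
  · rw [Pi.single_eq_of_ne h, map_zero]
    exact (tangentProj_tangentSingle_of_ne y h _).symm

theorem chartFrame_modelProj {x y : ∀ i, M i} (hy : y ∈ (chartAt (ModelPi E) x).source)
    (j : ι) (v : ∀ i, E i) :
    chartFrame (piModel E) x y (modelProj E j v) =
      tangentSingle y j (tangentProj y j (chartFrame (piModel E) x y v)) := by
  rw [tangentProj_chartFrame hy]
  exact chartFrame_single hy j (v j)

theorem chartFrame_single_eq {x y : ∀ i, M i} (hy : y ∈ (chartAt (ModelPi E) x).source)
    (j : ι) (v : E j) :
    chartFrame (piModel E) x y (Pi.single j v) =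
      tangentSingle y j (tangentProj y j (chartFrame (piModel E) x y (Pi.single j v))) := by
  rw [← chartFrame_modelProj hy]
  simp [modelProj]

end ProductFrame

/-! ### Eigenspaces, block diagonality and orthogonal projections. -/

section BlockDiagonal

variable {ι : Type*} [Fintype ι] [DecidableEq ι] {E : ι → Type*} [∀ i, NormedAddCommGroup (E i)]
  [∀ i, NormedSpace ℝ (E i)] {M : ι → Type*} [∀ i, TopologicalSpace (M i)]
  [∀ i, ChartedSpace (E i) (M i)]

namespace IsAdaptedToEigenspaces

variable {T : (x : ∀ i, M i) → TangentSpace (piModel E) x →L[ℝ] TangentSpace (piModel E) x}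
  {lam : ι → (∀ i, M i) → ℝ}

theorem apply_tangentSingle (h : IsAdaptedToEigenspaces T lam) (x : ∀ i, M i) (i : ι) (v : E i) :
    T x (tangentSingle x i v) = lam i x • tangentSingle x i v := by
  have := tangentSingle_mem_productNet x i v
  rw [← h.eigenspace_eq, Module.End.mem_eigenspace_iff] at this
  exact this

theorem nontrivial [Nonempty (∀ i, M i)] (h : IsAdaptedToEigenspaces T lam) (i : ι) :
    Nontrivial (E i) := by
  obtain ⟨x⟩ := ‹Nonempty (∀ i, M i)›
  obtain ⟨v, hv, hv0⟩ := (Submodule.ne_bot_iff _).1 (h.hasEigenvalue i x)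
  change v ∈ Module.End.eigenspace (T x).toLinearMap (lam i x) at hv
  rw [h.eigenspace_eq] at hv
  refine ⟨tangentProj x i v, 0, fun h0 ↦ hv0 ?_⟩
  rw [← tangentSingle_tangentProj_of_mem hv, h0, map_zero]

/-- Equal eigenvalues would make two slice tangent spaces coincide. These meet only in zero, but an
eigenvector is nonzero. -/
theorem lam_ne (h : IsAdaptedToEigenspaces T lam) (x : ∀ i, M i) {i j : ι} (hij : i ≠ j) :
    lam i x ≠ lam j x := by
  intro heq
  obtain ⟨v, hv, hv0⟩ := (Submodule.ne_bot_iff _).1 (h.hasEigenvalue i x)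
  change v ∈ Module.End.eigenspace (T x).toLinearMap (lam i x) at hv
  have hv' := hv
  rw [h.eigenspace_eq] at hv
  rw [heq, h.eigenspace_eq] at hv'
  exact hv0 (by rw [← tangentSingle_tangentProj_of_mem hv, mem_productNet.1 hv' i hij, map_zero])

theorem apply_eq_sum (h : IsAdaptedToEigenspaces T lam) (x : ∀ i, M i)
    (v : TangentSpace (piModel E) x) :
    T x v = ∑ i, lam i x • tangentSingle x i (tangentProj x i v) := by
  conv_lhs => rw [← sum_tangentSingle x v, map_sum]
  exact Finset.sum_congr rfl fun i _ ↦ h.apply_tangentSingle x i _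

end IsAdaptedToEigenspaces

variable [∀ i, IsManifold 𝓘(ℝ, E i) ∞ (M i)]

/-- The factors of the product are mutually orthogonal. -/
def PseudoRiemannianMetric.IsBlockDiagonal (g : PseudoRiemannianMetric (piModel E) (∀ i, M i)) :
    Prop :=
  ∀ (x : ∀ i, M i) (i j : ι), i ≠ j → ∀ (v : E i) (w : E j),
    g.inner x (tangentSingle x i v) (tangentSingle x j w) = 0

namespace PseudoRiemannianMetric.IsBlockDiagonal

variable {g : PseudoRiemannianMetric (piModel E) (∀ i, M i)}

theorem inner_tangentSingle_left (hg : g.IsBlockDiagonal) (x : ∀ i, M i) (i : ι) (v : E i)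
    (w : TangentSpace (piModel E) x) :
    g.inner x (tangentSingle x i v) w =
      g.inner x (tangentSingle x i v) (tangentSingle x i (tangentProj x i w)) := by
  conv_lhs => rw [← sum_tangentSingle x w, map_sum]
  exact Finset.sum_eq_single i (fun j _ hj ↦ hg x i j hj.symm v _) (by simp)

theorem inner_tangentSingle_right (hg : g.IsBlockDiagonal) (x : ∀ i, M i) (i : ι) (v : E i)
    (w : TangentSpace (piModel E) x) :
    g.inner x w (tangentSingle x i v) =
      g.inner x (tangentSingle x i (tangentProj x i w)) (tangentSingle x i v) := by
  rw [g.symm, hg.inner_tangentSingle_left, g.symm]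

theorem inner_eq_sum (hg : g.IsBlockDiagonal) (x : ∀ i, M i) (v w : TangentSpace (piModel E) x) :
    g.inner x v w = ∑ i, g.inner x (tangentSingle x i (tangentProj x i v))
      (tangentSingle x i (tangentProj x i w)) := by
  conv_lhs => rw [← sum_tangentSingle x v, map_sum, sum_apply]
  exact Finset.sum_congr rfl fun i _ ↦ hg.inner_tangentSingle_left x i _ w

theorem nondegenerate_block (hg : g.IsBlockDiagonal) (x : ∀ i, M i) (i : ι) (v : E i)
    (h : ∀ w : E i, g.inner x (tangentSingle x i v) (tangentSingle x i w) = 0) : v = 0 := by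
  have h0 : tangentSingle x i v = 0 := by
    refine g.nondegenerate x _ fun w ↦ ?_
    rw [hg.inner_tangentSingle_left, h]
  rw [← tangentProj_tangentSingle_self x i v, h0, map_zero]

/-- By polarization, a block all of whose vectors are null would be zero, against non-degeneracy. In
indefinite signature this replaces definiteness whenever `g_i(v, v)` has to be cancelled. -/
theorem exists_inner_self_ne_zero [Nontrivial (E i)] (hg : g.IsBlockDiagonal) (x : ∀ i, M i) :
    ∃ v : E i, g.inner x (tangentSingle x i v) (tangentSingle x i v) ≠ 0 := by
  by_contra! h
  obtain ⟨v, hv⟩ := exists_ne (0 : E i)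
  refine hv (hg.nondegenerate_block x i v fun w ↦ ?_)
  have h1 := h (v + w)
  simp only [map_add, add_apply] at h1
  rw [h v, h w, g.symm x (tangentSingle x i w) (tangentSingle x i v)] at h1
  linarith

/-- Ensures that `orthProj` onto a factor is the genuine projection and not its default value `0`.
-/
theorem isCompl_productNet (hg : g.IsBlockDiagonal) (x : ∀ i, M i) (i : ι) :
    IsCompl (productNet i x) ((g.form x).orthogonal (productNet i x)) := by
  have hmem : ∀ v : TangentSpace (piModel E) x, tangentProj x i v = 0 →
      v ∈ (g.form x).orthogonal (productNet i x) := by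
    intro v hv
    rw [LinearMap.BilinForm.mem_orthogonal_iff]
    intro w hw
    change g.inner x w v = 0
    rw [← tangentSingle_tangentProj_of_mem hw, hg.inner_tangentSingle_left, hv]
    simp
  refine ⟨?_, ?_⟩
  · rw [Submodule.disjoint_def]
    intro v hv hv'
    rw [LinearMap.BilinForm.mem_orthogonal_iff] at hv'
    rw [← tangentSingle_tangentProj_of_mem hv]
    have : tangentProj x i v = 0 := by
      refine hg.nondegenerate_block x i _ fun w ↦ ?_
      rw [tangentSingle_tangentProj_of_mem hv, g.symm]
      exact hv' _ (tangentSingle_mem_productNet x i w)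
    rw [this, map_zero]
  · rw [codisjoint_iff, eq_top_iff]
    intro v _
    rw [Submodule.mem_sup]
    exact ⟨tangentSingle x i (tangentProj x i v), tangentSingle_mem_productNet x i _,
      v - tangentSingle x i (tangentProj x i v), hmem _ (by simp), by simp⟩

theorem orthProj_productNet (hg : g.IsBlockDiagonal) (x : ∀ i, M i) (i : ι)
    (v : TangentSpace (piModel E) x) :
    g.orthProj x (productNet i x) v = tangentSingle x i (tangentProj x i v) := by
  rw [PseudoRiemannianMetric.orthProj, dif_pos (hg.isCompl_productNet x i)]
  have hw : v - tangentSingle x i (tangentProj x i v) ∈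
      (g.form x).orthogonal (productNet i x) := by
    rw [LinearMap.BilinForm.mem_orthogonal_iff]
    intro w hw
    change g.inner x w (v - tangentSingle x i (tangentProj x i v)) = 0
    rw [← tangentSingle_tangentProj_of_mem hw, hg.inner_tangentSingle_left]
    simp
  have hv : v = tangentSingle x i (tangentProj x i v) +
      (v - tangentSingle x i (tangentProj x i v)) := by simp
  conv_lhs => rw [hv, map_add]
  rw [Submodule.projection_apply_of_mem_left _ (tangentSingle_mem_productNet x i _),
    Submodule.projection_apply_of_mem_right _ hw, add_zero]

variable [∀ i, FiniteDimensional ℝ (E i)]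

/-- Equality of the normal part of a gradient with a sum of tangential parts, in terms of
differentials. -/
theorem perpProj_grad_eq_iff (hg : g.IsBlockDiagonal) (x : ∀ i, M i) (i : ι)
    (f : (∀ i, M i) → ℝ) (h : ι → (∀ i, M i) → ℝ) :
    g.perpProj x (productNet i x) (g.grad f x) =
        (1 / 2 : ℝ) • ∑ j ∈ Finset.univ.erase i, g.orthProj x (productNet j x) (g.grad (h j) x) ↔
      ∀ j, j ≠ i → ∀ v : E j, mvfderiv (piModel E) f x (tangentSingle x j v) =
        1 / 2 * mvfderiv (piModel E) (h j) x (tangentSingle x j v) := by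
  simp only [PseudoRiemannianMetric.perpProj, hg.orthProj_productNet]
  have key : ∀ j (u : TangentSpace (piModel E) x) (v : E j),
      g.inner x (tangentSingle x j (tangentProj x j u)) (tangentSingle x j v) =
        g.inner x u (tangentSingle x j v) :=
    fun j u v ↦ (hg.inner_tangentSingle_right x j v u).symm
  constructor
  · intro heq j hj v
    have h1 := congrArg (fun u ↦ g.inner x u (tangentSingle x j v)) heq
    simp only [map_sub, map_smul, map_sum, sub_apply, smul_apply,
      sum_apply, smul_eq_mul] at h1
    rw [hg x i j hj.symm, Finset.sum_eq_single j (fun k _ hk ↦ hg x k j hk _ _)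
      (by simp [hj]), key, g.inner_grad, g.inner_grad, sub_zero] at h1
    exact h1
  · intro heq
    apply tangent_ext
    intro j
    rw [← sub_eq_zero, ← map_sub]
    -- The `i`-th component vanishes on both sides, so testing against each block loses nothing.
    refine hg.nondegenerate_block x j _ fun v ↦ ?_
    rw [key]
    simp only [map_sub, map_smul, map_sum, sub_apply, smul_apply,
      sum_apply, smul_eq_mul]
    by_cases hj : j = i
    · subst hj
      rw [key, Finset.sum_eq_zero fun k hk ↦ hg x k j (Finset.ne_of_mem_erase hk) _ _]
      simp
    · rw [hg x i j (Ne.symm hj), Finset.sum_eq_single j (fun k _ hk ↦ hg x k j hk _ _)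
        (by simp [hj]), key, g.inner_grad, g.inner_grad, heq j hj v]
      ring

end PseudoRiemannianMetric.IsBlockDiagonal

/-- Eigenvectors of a self-adjoint map for distinct eigenvalues are orthogonal. -/
theorem IsAdaptedToEigenspaces.isBlockDiagonal {g : PseudoRiemannianMetric (piModel E) (∀ i, M i)}
    {T : (x : ∀ i, M i) → TangentSpace (piModel E) x →L[ℝ] TangentSpace (piModel E) x}
    {lam : ι → (∀ i, M i) → ℝ} (h : IsAdaptedToEigenspaces T lam) (hT : IsOrthogonalTensor g T) :
    g.IsBlockDiagonal := by
  intro x i j hij v w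
  have h1 := hT.selfAdjoint x (tangentSingle x i v) (tangentSingle x j w)
  rw [h.apply_tangentSingle, h.apply_tangentSingle] at h1
  simp only [map_smul, smul_apply, smul_eq_mul] at h1
  have h2 : (lam i x - lam j x) * g.inner x (tangentSingle x i v) (tangentSingle x j w) = 0 := by
    linarith
  exact (mul_eq_zero.1 h2).resolve_left (sub_ne_zero.2 (h.lam_ne x hij))

end BlockDiagonal

/-! ### First derivatives of the metric in charts and along factors. -/

section CoordDeriv

variable {E : Type*} [NormedAddCommGroup E] [NormedSpace ℝ E]
  {H : Type*} [TopologicalSpace H] {I : ModelWithCorners ℝ E H}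
  {M : Type*} [TopologicalSpace M] [ChartedSpace H M]

theorem Filter.EventuallyEq.mvfderiv_apply_eq {F : Type*} [NormedAddCommGroup F] [NormedSpace ℝ F]
    {x : M} {f f' : M → F} (h : f =ᶠ[𝓝 x] f') (v : TangentSpace I x) :
    mvfderiv I f x v = mvfderiv I f' x v :=
  congrArg (fun L : TangentSpace I x →L[ℝ] F ↦ L v) (h.mfderiv_eq (I := I) (I' := 𝓘(ℝ, F)))

variable [IsManifold I ∞ M]

theorem hasFDerivAt_comp_extChartAt_symm [I.Boundaryless] {F : Type*} [NormedAddCommGroup F]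
    [NormedSpace ℝ F] {x : M} {f : M → F} (hf : ContMDiffAt I 𝓘(ℝ, F) ∞ f x) :
    HasFDerivAt (f ∘ (extChartAt I x).symm) (show E →L[ℝ] F from mvfderiv I f x)
      (extChartAt I x x) := by
  have h := ((contDiffAt_comp_extChartAt_symm hf).differentiableAt (by simp)).hasFDerivAt
  have h2 := (hasMVFDeriv_of_comp_symm h).2
  convert h using 1
  ext v
  exact h2 v

namespace PseudoRiemannianMetric

set_option synthInstance.maxHeartbeats 200000 in
/-- The derivative at `x` of the metric in the coordinates of the preferred chart at `x`. -/
def coordDeriv (g : PseudoRiemannianMetric I M) (x : M) : E →L[ℝ] E →L[ℝ] E →L[ℝ] ℝ :=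
  fderiv ℝ (g.coord x ∘ (extChartAt I x).symm) (extChartAt I x x)

set_option synthInstance.maxHeartbeats 200000 in
theorem hasFDerivAt_coord [I.Boundaryless] (g : PseudoRiemannianMetric I M) (x : M) :
    HasFDerivAt (g.coord x ∘ (extChartAt I x).symm) (g.coordDeriv x) (extChartAt I x x) :=
  ((contDiffAt_comp_extChartAt_symm (g.contMDiffAt_coord x)).differentiableAt
    (by simp)).hasFDerivAt

set_option synthInstance.maxHeartbeats 200000 in
theorem mvfderiv_coord_apply [I.Boundaryless] (g : PseudoRiemannianMetric I M) (x : M) (v w : E) :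
    MDifferentiableAt I 𝓘(ℝ, ℝ) (fun y ↦ g.coord x y v w) x ∧
      ∀ a : E, mvfderiv I (fun y ↦ g.coord x y v w) x a = g.coordDeriv x a v w := by
  have h := ((g.hasFDerivAt_coord x).clm_apply (hasFDerivAt_const v _)).clm_apply
    (hasFDerivAt_const w _)
  have h2 := hasMVFDeriv_of_comp_symm (f := fun y ↦ g.coord x y v w) h
  refine ⟨h2.1, fun a ↦ ?_⟩
  rw [h2.2]
  simp

theorem coord_self_apply (g : PseudoRiemannianMetric I M) (x : M) (v w : E) :
    g.coord x x v w = g.inner x v w := by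
  rw [coord_apply, chartFrame_self, chartFrame_self]

variable [FiniteDimensional ℝ E]

theorem contravariant_apply (g : PseudoRiemannianMetric I M) (x : M)
    (α β : TangentSpace I x →L[ℝ] ℝ) : g.contravariant x α β = β (g.sharp x α) := by
  rw [← g.inner_sharp x β, g.symm, g.inner_sharp]
  rfl

theorem raise_apply (g : PseudoRiemannianMetric I M)
    {T : (x : M) → TangentSpace I x →L[ℝ] TangentSpace I x}
    (hT : ∀ x v w, g.inner x (T x v) w = g.inner x v (T x w)) (x : M)
    (α β : TangentSpace I x →L[ℝ] ℝ) : g.raise T x α β = β (T x (g.sharp x α)) := by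
  rw [← g.inner_sharp x β, g.symm, hT, g.inner_sharp]
  rfl

theorem gradCoord_self (g : PseudoRiemannianMetric I M) (f : M → ℝ) (x : M) :
    g.gradCoord f x x = g.grad f x := by
  have h := chartFrame_chartCoframe (I := I) (mem_chart_source H x) (g.grad f x)
  rw [chartFrame_self] at h
  exact h

/-- Take for `f` the functional `⟨X, ·⟩` composed with the chart. Conditions on all differentials
thereby become conditions on all vectors. -/
theorem exists_grad_eq [I.Boundaryless] (g : PseudoRiemannianMetric I M) (x : M)
    (X : TangentSpace I x) :
    ∃ f : M → ℝ, ContMDiffAt I 𝓘(ℝ, ℝ) ∞ f x ∧ g.grad f x = X := by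
  let L : E →L[ℝ] ℝ := g.inner x X
  refine ⟨L ∘ extChartAt I x, L.contMDiff.contMDiffAt.comp x contMDiffAt_extChartAt, ?_⟩
  have h1 : HasFDerivAt ((L ∘ extChartAt I x) ∘ (extChartAt I x).symm) L (extChartAt I x x) := by
    refine L.hasFDerivAt.congr_of_eventuallyEq ?_
    filter_upwards [extChartAt_target_mem_nhds (I := I) x] with z hz
    exact congrArg L ((extChartAt I x).right_inv hz)
  rw [← sub_eq_zero]
  refine g.nondegenerate x _ fun w ↦ ?_
  have h2 := (hasMVFDeriv_of_comp_symm h1).2 w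
  rw [map_sub, sub_apply, inner_grad, h2]
  exact sub_self _

end PseudoRiemannianMetric

end CoordDeriv

section ProductDeriv

variable {ι : Type*} [Fintype ι] [DecidableEq ι] {E : ι → Type*} [∀ i, NormedAddCommGroup (E i)]
  [∀ i, NormedSpace ℝ (E i)] {M : ι → Type*} [∀ i, TopologicalSpace (M i)]
  [∀ i, ChartedSpace (E i) (M i)]

theorem mvfderiv_comp_update {F : Type*} [NormedAddCommGroup F]
    [NormedSpace ℝ F] {f : (∀ i, M i) → F} {x : ∀ i, M i} (i : ι)
    (hf : MDifferentiableAt (piModel E) 𝓘(ℝ, F) f x) :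
    MDifferentiableAt 𝓘(ℝ, E i) 𝓘(ℝ, F) (fun y ↦ f (Function.update x i y)) (x i) ∧
    ∀ a : E i, mvfderiv 𝓘(ℝ, E i) (fun y ↦ f (Function.update x i y)) (x i) a =
      mvfderiv (piModel E) f x (tangentSingle x i a) := by
  have hu : MDifferentiableAt 𝓘(ℝ, E i) (piModel E) (fun y : M i ↦ Function.update x i y) (x i) :=
    (contMDiff_update (n := 1) x i).mdifferentiable one_ne_zero (x i)
  have hx : Function.update x i (x i) = x := Function.update_eq_self i x
  have hf' : MDifferentiableAt (piModel E) 𝓘(ℝ, F) f (Function.update x i (x i)) := by rwa [hx]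
  have h := HasMFDerivAt.comp (x i) hf'.hasMFDerivAt hu.hasMFDerivAt
  refine ⟨h.mdifferentiableAt, fun a ↦ ?_⟩
  -- The chain rule lands in the tangent space at `Function.update x i (x i)`, a point only
  -- propositionally equal to `x`.
  have h3 : ∀ x', x' = x → mvfderiv (piModel E) f x' (tangentSingle x' i a) =
      mvfderiv (piModel E) f x (tangentSingle x i a) := by
    rintro _ rfl
    rfl
  rw [← h3 _ hx, ← mfderiv_update x i (x i) a]
  exact congrArg (fun L ↦ L a) h.mfderiv

variable [∀ i, IsManifold 𝓘(ℝ, E i) ∞ (M i)]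

namespace PseudoRiemannianMetric

variable (g : PseudoRiemannianMetric (piModel E) (∀ i, M i))

/-- Moving only the `i`-th coordinate leaves the `j`-th chart frame at its centre, where it is the
identity. Coordinate derivatives of the `j`-th block along the `i`-th factor are thus derivatives of
the block itself. -/
theorem coord_update_single (x : ∀ i, M i) {i j : ι} (hij : i ≠ j) {y : M i}
    (hy : y ∈ (chartAt (E i) (x i)).source) (v w : E j) :
    g.coord x (Function.update x i y) (Pi.single j v) (Pi.single j w) =
      g.inner (Function.update x i y) (tangentSingle _ j v) (tangentSingle _ j w) := by
  have hs : Function.update x i y ∈ (chartAt (ModelPi E) x).source := by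
    rw [piChartedSpace_chartAt]
    intro k _
    by_cases hk : k = i
    · subst hk; simpa using hy
    · simp [Function.update_of_ne hk]
  have key : ∀ u : E j, chartFrame (piModel E) x (Function.update x i y) (Pi.single j u) =
      tangentSingle (Function.update x i y) j u := by
    intro u
    rw [chartFrame_single hs]
    congr 1
    rw [Function.update_of_ne hij.symm]
    exact chartFrame_self (x j) u
  rw [coord_apply, key, key]

/-- The derivative of the `j`-th block of the metric along the `i`-th factor. -/
theorem mvfderiv_inner_update (x : ∀ i, M i) {i j : ι} (hij : i ≠ j) (v w : E j) :
    MDifferentiableAt 𝓘(ℝ, E i) 𝓘(ℝ, ℝ) (fun y ↦ g.inner (Function.update x i y)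
      (tangentSingle _ j v) (tangentSingle _ j w)) (x i) ∧
    ∀ a : E i, mvfderiv 𝓘(ℝ, E i) (fun y ↦ g.inner (Function.update x i y)
      (tangentSingle _ j v) (tangentSingle _ j w)) (x i) a =
        g.coordDeriv x (Pi.single i a) (Pi.single j v) (Pi.single j w) := by
  have h1 := g.mvfderiv_coord_apply x (Pi.single j v) (Pi.single j w)
  have h2 := mvfderiv_comp_update i h1.1
  have h3 : (fun y ↦ g.inner (Function.update x i y) (tangentSingle _ j v) (tangentSingle _ j w))
      =ᶠ[𝓝 (x i)] fun y ↦ g.coord x (Function.update x i y) (Pi.single j v) (Pi.single j w) := by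
    filter_upwards [(chartAt (E i) (x i)).open_source.mem_nhds (mem_chart_source _ (x i))]
      with y hy
    exact (g.coord_update_single x hij hy v w).symm
  refine ⟨h2.1.congr_of_eventuallyEq h3, fun a ↦ ?_⟩
  exact (h3.mvfderiv_apply_eq (I := 𝓘(ℝ, E i)) a).trans ((h2.2 a).trans (h1.2 _))

end PseudoRiemannianMetric

namespace IsAdaptedToEigenspaces

variable {g : PseudoRiemannianMetric (piModel E) (∀ i, M i)}
  {T : (x : ∀ i, M i) → TangentSpace (piModel E) x →L[ℝ] TangentSpace (piModel E) x}
  {lam : ι → (∀ i, M i) → ℝ}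

/-- Smoothness of the eigenfunctions is inherited from `T`: apply `T` to a frame vector of the
`i`-th factor and read off its coefficient with a functional equal to `1` on that vector. -/
theorem contMDiff_lam (h : IsAdaptedToEigenspaces T lam) (hT : IsOrthogonalTensor g T) (i : ι) :
    ContMDiff (piModel E) 𝓘(ℝ, ℝ) ∞ (lam i) := by
  intro x
  have : Nonempty (∀ i, M i) := ⟨x⟩
  have := h.nontrivial i
  obtain ⟨v, hv⟩ := exists_ne (0 : E i)
  obtain ⟨ℓ, hℓ⟩ := SeparatingDual.exists_eq_one (R := ℝ) hv
  have h1 : ContMDiffAt (piModel E) (piModel E).tangent ∞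
      (fun y ↦ (⟨y, T y (chartFrame (piModel E) x y (Pi.single i v))⟩ :
        TangentBundle (piModel E) (∀ i, M i))) x :=
    (hT.contMDiff x).clm_bundle_apply (contMDiffAt_chartFrame (mem_chart_source _ x) _)
  rw [contMDiffAt_vectorField_iff] at h1
  have h2 := ((ℓ.comp (ContinuousLinearMap.proj (R := ℝ) (φ := E) i)).contMDiff.contMDiffAt).comp x
    h1
  refine h2.congr_of_eventuallyEq ?_
  filter_upwards [(chartAt (ModelPi E) x).open_source.mem_nhds (mem_chart_source _ x)] with y hy
  have h3 : chartCoframe (piModel E) x y (T y (chartFrame (piModel E) x y (Pi.single i v))) =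
      lam i y • Pi.single i v := by
    rw [chartFrame_single_eq hy, h.apply_tangentSingle, map_smul, ← chartFrame_single_eq hy,
      chartCoframe_chartFrame hy]
  simp [h3, hℓ]

end IsAdaptedToEigenspaces

end ProductDeriv

/-! ### The Schouten bracket as a cubic form in the gradient. -/

section Hessian

variable {ι : Type*} [Fintype ι] {E : ι → Type*} [∀ i, NormedAddCommGroup (E i)]
  [∀ i, NormedSpace ℝ (E i)] {M : ι → Type*} [∀ i, TopologicalSpace (M i)]
  [∀ i, ChartedSpace (E i) (M i)]

/-- The second derivative at `x` of a function in the preferred chart at `x`. -/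
def coordHessian (f : (∀ i, M i) → ℝ) (x : ∀ i, M i) : (∀ i, E i) →L[ℝ] (∀ i, E i) →L[ℝ] ℝ :=
  fderiv ℝ (fderiv ℝ (f ∘ (extChartAt (piModel E) x).symm)) (extChartAt (piModel E) x x)

theorem coordHessian_symm {f : (∀ i, M i) → ℝ} {x : ∀ i, M i}
    (hf : ContMDiffAt (piModel E) 𝓘(ℝ, ℝ) ∞ f x) (v w : ∀ i, E i) :
    coordHessian f x v w = coordHessian f x w v :=
  ((contDiffAt_comp_extChartAt_symm hf).isSymmSndFDerivAt
    (by simpa using ENat.LEInfty.out)) v w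

end Hessian

section Bracket

variable {ι : Type*} [Fintype ι] [DecidableEq ι] {E : ι → Type*} [∀ i, NormedAddCommGroup (E i)]
  [∀ i, NormedSpace ℝ (E i)]
  {M : ι → Type*} [∀ i, TopologicalSpace (M i)]
  [∀ i, ChartedSpace (E i) (M i)] [∀ i, IsManifold 𝓘(ℝ, E i) ∞ (M i)]
  {g : PseudoRiemannianMetric (piModel E) (∀ i, M i)}

theorem PseudoRiemannianMetric.IsBlockDiagonal.coord_modelProj (hg : g.IsBlockDiagonal)
    {x y : ∀ i, M i} (hy : y ∈ (chartAt (ModelPi E) x).source) (j : ι) (v w : ∀ i, E i) :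
    g.coord x y (modelProj E j v) w = g.coord x y v (modelProj E j w) := by
  rw [g.coord_apply, g.coord_apply, chartFrame_modelProj hy, chartFrame_modelProj hy,
    hg.inner_tangentSingle_left, ← hg.inner_tangentSingle_right]

variable [∀ i, FiniteDimensional ℝ (E i)]

/-- The part of `G(df, df)` belonging to the `j`-th factor. -/
def PseudoRiemannianMetric.blockNorm (g : PseudoRiemannianMetric (piModel E) (∀ i, M i))
    (f : (∀ i, M i) → ℝ) (j : ι) (y : ∀ i, M i) : ℝ :=
  mvfderiv (piModel E) f y (tangentSingle y j (tangentProj y j (g.grad f y)))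

/-- Instance of `hasFDerivAt_pairing`: the derivative of the gradient is eliminated, leaving the
Hessian of `f` and the first derivative of `g`. -/
theorem PseudoRiemannianMetric.IsBlockDiagonal.hasFDerivAt_blockNorm (hg : g.IsBlockDiagonal)
    {f : (∀ i, M i) → ℝ} {x : ∀ i, M i} (hf : ContMDiffAt (piModel E) 𝓘(ℝ, ℝ) ∞ f x) (j : ι)
    (X : ∀ i, E i) (hX : g.grad f x = X) :
    ∃ L : (∀ i, E i) →L[ℝ] ℝ,
      HasFDerivAt (g.blockNorm f j ∘ (extChartAt (piModel E) x).symm) L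
        (extChartAt (piModel E) x x) ∧
      ∀ a, L a = 2 * coordHessian f x a (modelProj E j X) -
        g.coordDeriv x a (modelProj E j X) (modelProj E j X) := by
  have hsrc : ∀ᶠ z in 𝓝 (extChartAt (piModel E) x x),
      (extChartAt (piModel E) x).symm z ∈ (chartAt (ModelPi E) x).source :=
    (tendsto_extChartAt_symm x).eventually
      ((chartAt (ModelPi E) x).open_source.mem_nhds (mem_chart_source _ x))
  have hto : (extChartAt (piModel E) x).symm (extChartAt (piModel E) x x) = x :=
    extChartAt_to_inv x
  have hA : HasFDerivAt (diffCoord (piModel E) f x ∘ (extChartAt (piModel E) x).symm)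
      (coordHessian f x) (extChartAt (piModel E) x x) := by
    refine HasFDerivAt.congr_of_eventuallyEq ?_ (diffCoord_comp_symm_eventuallyEq hf)
    exact (((contDiffAt_comp_extChartAt_symm hf).fderiv_right (m := ∞) (by simp)).differentiableAt
      (by simp)).hasFDerivAt
  have hXd : DifferentiableAt ℝ (g.gradCoord f x ∘ (extChartAt (piModel E) x).symm)
      (extChartAt (piModel E) x x) :=
    (contDiffAt_comp_extChartAt_symm (g.contMDiffAt_gradCoord hf)).differentiableAt (by simp)
  obtain ⟨L, hL, hL'⟩ := hasFDerivAt_pairing (P := modelProj E j) (g.hasFDerivAt_coord x) hA hXd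
    (by filter_upwards [hsrc] with z hz using g.coord_gradCoord f hz)
    (by
      intro v w
      simp only [Function.comp_apply, hto, g.coord_self_apply]
      exact g.symm x v w)
    (by filter_upwards [hsrc] with z hz using fun v w ↦ hg.coord_modelProj hz j v w)
    (modelProj_modelProj j)
  refine ⟨L, hL.congr_of_eventuallyEq ?_, fun a ↦ ?_⟩
  · filter_upwards [hsrc] with z hz
    simp only [Function.comp_apply, PseudoRiemannianMetric.blockNorm]
    change _ = mvfderiv (piModel E) f _ (chartFrame (piModel E) x _ _)
    rw [chartFrame_modelProj hz, PseudoRiemannianMetric.gradCoord, chartFrame_chartCoframe hz]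
  · have : (g.gradCoord f x ∘ (extChartAt (piModel E) x).symm) (extChartAt (piModel E) x x) =
        X := by
      simp only [Function.comp_apply, hto, g.gradCoord_self]
      exact hX
    rw [hL', this]

/-- Cancels the second derivatives of `f` in the bracket. -/
theorem sum_antisymm_mul_symm {ι : Type*} [Fintype ι] (l : ι → ℝ) (h : ι → ι → ℝ)
    (hs : ∀ i j, h i j = h j i) : ∑ i, ∑ j, (l i - l j) * h i j = 0 := by
  have h1 : ∑ i, ∑ j, (l i - l j) * h i j = ∑ i, ∑ j, (l j - l i) * h i j := by
    rw [Finset.sum_comm]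
    exact Finset.sum_congr rfl fun i _ ↦ Finset.sum_congr rfl fun j _ ↦ by rw [hs]
  have h2 : ∑ i, ∑ j, (l j - l i) * h i j = -∑ i, ∑ j, (l i - l j) * h i j := by
    simp_rw [← Finset.sum_neg_distrib]
    exact Finset.sum_congr rfl fun i _ ↦ Finset.sum_congr rfl fun j _ ↦ by ring
  linarith

/-- The cubic form `∑ (λ_i - λ_j) ∂_{X_i} g_j (X_j, X_j) + g_j (X_j, X_j) dλ_j (X_i)`. -/
def bracketForm (g : PseudoRiemannianMetric (piModel E) (∀ i, M i)) (lam : ι → (∀ i, M i) → ℝ)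
    (x : ∀ i, M i) (X : ∀ i, E i) : ℝ :=
  ∑ i, ∑ j, ((lam i x - lam j x) *
      g.coordDeriv x (Pi.single i (X i)) (Pi.single j (X j)) (Pi.single j (X j)) +
    g.inner x (tangentSingle x j (X j)) (tangentSingle x j (X j)) *
      mvfderiv (piModel E) (lam j) x (tangentSingle x i (X i)))

/-- Here `G(df, df)` is the sum of the block norms and `K(df, df)` the same sum weighted by `λ_j`,
while `T X` weights the directions by `λ_i`. The Hessian therefore enters with the factor `λ_i -
λ_j` and cancels. -/
theorem schoutenBracket_eq
    {T : (x : ∀ i, M i) → TangentSpace (piModel E) x →L[ℝ] TangentSpace (piModel E) x}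
    (hT : IsOrthogonalTensor g T)
    {lam : ι → (∀ i, M i) → ℝ} (hadapted : IsAdaptedToEigenspaces T lam)
    {f : (∀ i, M i) → ℝ} {x : ∀ i, M i} (hf : ContMDiffAt (piModel E) 𝓘(ℝ, ℝ) ∞ f x)
    (X : ∀ i, E i) (hX : g.grad f x = X) :
    schoutenBracket (I := piModel E) (g.raise T) g.contravariant f x =
      -2 * bracketForm g lam x X := by
  have hg := hadapted.isBlockDiagonal hT
  have hlam := fun j ↦ hadapted.contMDiff_lam hT j
  choose L hL hL' using fun j ↦ hg.hasFDerivAt_blockNorm hf j X hX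
  have hU : (fun y ↦ g.contravariant y (mvfderiv (piModel E) f y) (mvfderiv (piModel E) f y)) =
      fun y ↦ ∑ j, g.blockNorm f j y := by
    ext y
    change mvfderiv (piModel E) f y (g.grad f y) = _
    conv_lhs => rw [← sum_tangentSingle y (g.grad f y), map_sum]
    rfl
  have hK : (fun y ↦ g.raise T y (mvfderiv (piModel E) f y) (mvfderiv (piModel E) f y)) =
      fun y ↦ ∑ j, lam j y * g.blockNorm f j y := by
    ext y
    change mvfderiv (piModel E) f y (T y (g.grad f y)) = _
    rw [hadapted.apply_eq_sum, map_sum]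
    exact Finset.sum_congr rfl fun j _ ↦ by rw [map_smul, smul_eq_mul]; rfl
  have hUd : ∀ v : ∀ i, E i,
      mvfderiv (piModel E) (fun y ↦ ∑ j, g.blockNorm f j y) x v = ∑ j, L j v := by
    have := HasFDerivAt.fun_sum (u := Finset.univ) fun j _ ↦ hL j
    intro v
    rw [(hasMVFDeriv_of_comp_symm (f := fun y ↦ ∑ j, g.blockNorm f j y) this).2 v]
    simp
  have hval : ∀ j, g.blockNorm f j x =
      g.inner x (tangentSingle x j (X j)) (tangentSingle x j (X j)) := by
    intro j
    rw [PseudoRiemannianMetric.blockNorm, ← g.inner_grad, hg.inner_tangentSingle_right, hX]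
    rfl
  have hKd : ∀ v : ∀ i, E i,
      mvfderiv (piModel E) (fun y ↦ ∑ j, lam j y * g.blockNorm f j y) x v =
        ∑ j, (lam j x * L j v + g.inner x (tangentSingle x j (X j)) (tangentSingle x j (X j)) *
          mvfderiv (piModel E) (lam j) x v) := by
    have := HasFDerivAt.fun_sum (u := Finset.univ) fun j _ ↦
      (hasFDerivAt_comp_extChartAt_symm (hlam j x)).mul (hL j)
    intro v
    rw [(hasMVFDeriv_of_comp_symm (f := fun y ↦ ∑ j, lam j y * g.blockNorm f j y) this).2 v]
    have hto : (extChartAt (piModel E) x).symm (extChartAt (piModel E) x x) = x :=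
      extChartAt_to_inv x
    simp only [sum_apply, Function.comp_apply, hto, hval]
    rfl
  rw [schoutenBracket, hU, hK, g.raise_apply hT.selfAdjoint, g.contravariant_apply]
  change 2 * (mvfderiv (piModel E) _ x (T x (g.grad f x)) -
    mvfderiv (piModel E) _ x (g.grad f x)) = _
  have hTX : T x X = ∑ i, lam i x • modelProj E i X := hadapted.apply_eq_sum x X
  have hXs : X = ∑ i, modelProj E i X := (sum_tangentSingle x X).symm
  have e1 : mvfderiv (piModel E) (fun y ↦ ∑ j, g.blockNorm f j y) x (T x (g.grad f x)) =
      ∑ i, ∑ j, lam i x * L j (modelProj E i X) := by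
    rw [hX]
    refine (congrArg _ hTX).trans ?_
    rw [hUd, Finset.sum_comm]
    refine Finset.sum_congr rfl fun j _ ↦ ?_
    rw [map_sum]
    exact Finset.sum_congr rfl fun i _ ↦ by rw [map_smul, smul_eq_mul]
  have e2 : mvfderiv (piModel E) (fun y ↦ ∑ j, lam j y * g.blockNorm f j y) x (g.grad f x) =
      ∑ i, ∑ j, (lam j x * L j (modelProj E i X) +
        g.inner x (tangentSingle x j (X j)) (tangentSingle x j (X j)) *
          mvfderiv (piModel E) (lam j) x (tangentSingle x i (X i))) := by
    rw [hX]
    refine (congrArg _ hXs).trans ?_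
    refine (map_sum (mvfderiv (piModel E) _ x) _ _).trans ?_
    exact Finset.sum_congr rfl fun i _ ↦ hKd _
  rw [e1, e2, ← Finset.sum_sub_distrib]
  simp_rw [← Finset.sum_sub_distrib, hL']
  have e3 := sum_antisymm_mul_symm (fun i ↦ lam i x)
    (fun i j ↦ coordHessian f x (modelProj E i X) (modelProj E j X))
    (fun i j ↦ coordHessian_symm hf _ _)
  have e4 : ∀ i j, lam i x * (2 * coordHessian f x (modelProj E i X) (modelProj E j X) -
        g.coordDeriv x (modelProj E i X) (modelProj E j X) (modelProj E j X)) -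
      (lam j x * (2 * coordHessian f x (modelProj E i X) (modelProj E j X) -
        g.coordDeriv x (modelProj E i X) (modelProj E j X) (modelProj E j X)) +
        g.inner x (tangentSingle x j (X j)) (tangentSingle x j (X j)) *
          mvfderiv (piModel E) (lam j) x (tangentSingle x i (X i))) =
      2 * ((lam i x - lam j x) * coordHessian f x (modelProj E i X) (modelProj E j X)) -
      ((lam i x - lam j x) *
        g.coordDeriv x (modelProj E i X) (modelProj E j X) (modelProj E j X) +
        g.inner x (tangentSingle x j (X j)) (tangentSingle x j (X j)) *
          mvfderiv (piModel E) (lam j) x (tangentSingle x i (X i))) := fun i j ↦ by ring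
  simp_rw [e4, Finset.sum_sub_distrib, ← Finset.mul_sum, e3]
  rw [mul_zero, zero_sub, mul_neg, neg_mul]
  rfl

theorem isConformalKilling_iff
    {T : (x : ∀ i, M i) → TangentSpace (piModel E) x →L[ℝ] TangentSpace (piModel E) x}
    (hT : IsOrthogonalTensor g T)
    {lam : ι → (∀ i, M i) → ℝ} (hadapted : IsAdaptedToEigenspaces T lam) :
    IsConformalKilling g T ↔ ∃ C : (x : ∀ i, M i) → TangentSpace (piModel E) x,
      ContMDiff (piModel E) (piModel E).tangent ∞
        (fun x ↦ (⟨x, C x⟩ : TangentBundle (piModel E) (∀ i, M i))) ∧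
      ∀ x (X : ∀ i, E i), bracketForm g lam x X = g.inner x X (C x) * g.inner x X X := by
  refine exists_congr fun C ↦ and_congr_right fun _ ↦ forall_congr' fun x ↦ ?_
  have key : ∀ (f : (∀ i, M i) → ℝ) (X : ∀ i, E i), g.grad f x = X →
      -2 * (mvfderiv (piModel E) f x (C x) *
        g.contravariant x (mvfderiv (piModel E) f x) (mvfderiv (piModel E) f x)) =
      -2 * (g.inner x X (C x) * g.inner x X X) := by
    intro f X hX
    rw [← g.inner_grad, hX, g.contravariant_apply]
    change -2 * (_ * mvfderiv (piModel E) f x (g.grad f x)) = _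
    rw [← g.inner_grad, hX]
  constructor
  · intro h X
    obtain ⟨f, hf, hfX⟩ := g.exists_grad_eq x X
    have h1 := h f hf
    rw [schoutenBracket_eq hT hadapted hf X hfX, key f X hfX] at h1
    linarith
  · intro h f hf
    rw [schoutenBracket_eq hT hadapted hf (g.grad f x) rfl, key f (g.grad f x) rfl]
    rw [h (g.grad f x)]

end Bracket

/-! ### The conformal Killing equation as a scaling law for the blocks. -/

section KillingEquation

/-- A non-null `v` has `ℓ v = 0`. If `ℓ a ≠ 0`, then `ℓ` is nonzero at `a` and `a ± v`, which are
therefore null, and the parallelogram identity makes `v` null. -/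
theorem linearMap_eq_zero_of_mul_quadratic_eq_zero {V : Type*} [AddCommGroup V] [Module ℝ V]
    (ℓ : V →ₗ[ℝ] ℝ) (B : V →ₗ[ℝ] V →ₗ[ℝ] ℝ) (hB : ∃ v, B v v ≠ 0)
    (h : ∀ v, ℓ v * B v v = 0) (a : V) : ℓ a = 0 := by
  obtain ⟨v, hv⟩ := hB
  have hℓv : ℓ v = 0 := (mul_eq_zero.1 (h v)).resolve_right hv
  by_contra ha
  have h0 : B a a = 0 := (mul_eq_zero.1 (h a)).resolve_left ha
  have h1 : B (a + v) (a + v) = 0 := (mul_eq_zero.1 (h (a + v))).resolve_left (by simpa [hℓv])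
  have h2 : B (a - v) (a - v) = 0 := (mul_eq_zero.1 (h (a - v))).resolve_left (by simpa [hℓv])
  simp only [map_add, map_sub, LinearMap.add_apply, LinearMap.sub_apply] at h1 h2
  exact hv (by linarith)

variable {ι : Type*} [Fintype ι] [DecidableEq ι] {E : ι → Type*} [∀ i, NormedAddCommGroup (E i)]
  [∀ i, NormedSpace ℝ (E i)]
  {M : ι → Type*} [∀ i, TopologicalSpace (M i)]
  [∀ i, ChartedSpace (E i) (M i)] [∀ i, IsManifold 𝓘(ℝ, E i) ∞ (M i)]
  {g : PseudoRiemannianMetric (piModel E) (∀ i, M i)}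

/-- The `j`-th block of the metric scales with `λ_i - λ_j` along the `i`-th factor. -/
def BlockScaling (g : PseudoRiemannianMetric (piModel E) (∀ i, M i)) (lam : ι → (∀ i, M i) → ℝ) :
    Prop :=
  ∀ (x : ∀ i, M i) (i j : ι), i ≠ j → ∀ (a : E i) (v : E j),
    (lam i x - lam j x) * g.coordDeriv x (Pi.single i a) (Pi.single j v) (Pi.single j v) =
      (mvfderiv (piModel E) (lam i) x (tangentSingle x i a) -
        mvfderiv (piModel E) (lam j) x (tangentSingle x i a)) *
        g.inner x (tangentSingle x j v) (tangentSingle x j v)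

/-- The summands of `bracketForm`. -/
def bracketTerm (g : PseudoRiemannianMetric (piModel E) (∀ i, M i)) (lam : ι → (∀ i, M i) → ℝ)
    (x : ∀ i, M i) {i j : ι} (a : E i) (v : E j) : ℝ :=
  (lam i x - lam j x) * g.coordDeriv x (Pi.single i a) (Pi.single j v) (Pi.single j v) +
    g.inner x (tangentSingle x j v) (tangentSingle x j v) *
      mvfderiv (piModel E) (lam j) x (tangentSingle x i a)

set_option synthInstance.maxHeartbeats 200000 in
theorem bracketTerm_zero_left (lam : ι → (∀ i, M i) → ℝ) (x : ∀ i, M i) {i j : ι} (v : E j) :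
    bracketTerm g lam x (0 : E i) v = 0 := by
  simp [bracketTerm]

set_option synthInstance.maxHeartbeats 200000 in
theorem bracketTerm_zero_right (lam : ι → (∀ i, M i) → ℝ) (x : ∀ i, M i) {i j : ι} (a : E i) :
    bracketTerm g lam x a (0 : E j) = 0 := by
  simp [bracketTerm]

set_option synthInstance.maxHeartbeats 200000 in
theorem bracketTerm_neg_left (lam : ι → (∀ i, M i) → ℝ) (x : ∀ i, M i) {i j : ι} (a : E i)
    (v : E j) : bracketTerm g lam x (-a) v = -bracketTerm g lam x a v := by
  simp only [bracketTerm, Pi.single_neg, map_neg, neg_apply]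
  ring

set_option synthInstance.maxHeartbeats 200000 in
theorem bracketTerm_neg_right (lam : ι → (∀ i, M i) → ℝ) (x : ∀ i, M i) {i j : ι} (a : E i)
    (v : E j) : bracketTerm g lam x a (-v) = bracketTerm g lam x a v := by
  simp only [bracketTerm, Pi.single_neg, map_neg, neg_apply, neg_neg]

theorem bracketForm_eq_sum (lam : ι → (∀ i, M i) → ℝ) (x : ∀ i, M i) (X : ∀ i, E i) :
    bracketForm g lam x X = ∑ i, ∑ j, bracketTerm g lam x (X i) (X j) := rfl

theorem bracketForm_single (lam : ι → (∀ i, M i) → ℝ) (x : ∀ i, M i) (i : ι) (a : E i) :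
    bracketForm g lam x (Pi.single i a) = bracketTerm g lam x a a := by
  rw [bracketForm_eq_sum, Finset.sum_eq_single i, Finset.sum_eq_single i]
  · simp
  · intro k _ hk
    rw [Pi.single_eq_of_ne hk, bracketTerm_zero_right]
  · simp
  · intro k _ hk
    simp only [Pi.single_eq_of_ne hk, bracketTerm_zero_left, Finset.sum_const_zero]
  · simp

theorem bracketForm_single_add_single (lam : ι → (∀ i, M i) → ℝ) (x : ∀ i, M i) {i j : ι}
    (hij : i ≠ j) (a : E i) (v : E j) :
    bracketForm g lam x (Pi.single i a + Pi.single j v) =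
      bracketTerm g lam x a a + bracketTerm g lam x a v +
        (bracketTerm g lam x v a + bracketTerm g lam x v v) := by
  have hi : (Pi.single i a + Pi.single j v : ∀ i, E i) i = a := by
    simp [Pi.single_eq_of_ne hij]
  have hj : (Pi.single i a + Pi.single j v : ∀ i, E i) j = v := by
    simp [Pi.single_eq_of_ne hij.symm]
  have hk : ∀ k, k ≠ i ∧ k ≠ j → (Pi.single i a + Pi.single j v : ∀ i, E i) k = 0 := by
    intro k hk
    simp [Pi.single_eq_of_ne hk.1, Pi.single_eq_of_ne hk.2]
  have hs : ∀ k (b : E k), ∑ l, bracketTerm g lam x b ((Pi.single i a + Pi.single j v : ∀ i, E i) l)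
      = bracketTerm g lam x b a + bracketTerm g lam x b v := by
    intro k b
    rw [Finset.sum_eq_add i j hij (fun l _ hl ↦ by rw [hk l hl, bracketTerm_zero_right])
      (by simp) (by simp), hi, hj]
  rw [bracketForm_eq_sum, Finset.sum_eq_add i j hij _ (by simp) (by simp), hs, hs, hi, hj]
  intro l _ hl
  rw [hs, hk l hl, bracketTerm_zero_left, bracketTerm_zero_left, add_zero]

/-- Vectors in one block identify `⟨·, C⟩` there with `dλ_i`; vectors in two blocks then yield the
mixed terms. -/
theorem blockScaling_of_bracketForm_eq (hg : g.IsBlockDiagonal) [∀ i, Nontrivial (E i)]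
    {lam : ι → (∀ i, M i) → ℝ} {C : (x : ∀ i, M i) → TangentSpace (piModel E) x}
    (h : ∀ x (X : ∀ i, E i), bracketForm g lam x X = g.inner x X (C x) * g.inner x X X) :
    BlockScaling g lam := by
  intro x i j hij a v
  have hdiag : ∀ b : E i, bracketTerm g lam x b b =
      g.inner x (tangentSingle x i b) (C x) *
        g.inner x (tangentSingle x i b) (tangentSingle x i b) := by
    intro b
    rw [← bracketForm_single]
    exact h x (Pi.single i b)
  have hlin : mvfderiv (piModel E) (lam i) x (tangentSingle x i a) =
      g.inner x (tangentSingle x i a) (C x) := by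
    let ℓ : E i →L[ℝ] ℝ := (mvfderiv (piModel E) (lam i) x - g.inner x (C x)).comp
      (tangentSingle x i)
    let B : E i →ₗ[ℝ] E i →ₗ[ℝ] ℝ :=
      (g.form x).compl₁₂ (tangentSingle x i).toLinearMap (tangentSingle x i).toLinearMap
    have h0 := linearMap_eq_zero_of_mul_quadratic_eq_zero ℓ.toLinearMap B
      (hg.exists_inner_self_ne_zero (i := i) x) (fun b ↦ by
        have h1 := hdiag b
        rw [bracketTerm, sub_self, zero_mul, zero_add] at h1
        change (mvfderiv (piModel E) (lam i) x (tangentSingle x i b) -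
          g.inner x (C x) (tangentSingle x i b)) *
            g.inner x (tangentSingle x i b) (tangentSingle x i b) = 0
        rw [g.symm x (C x)]
        linarith) a
    change mvfderiv (piModel E) (lam i) x (tangentSingle x i a) -
      g.inner x (C x) (tangentSingle x i a) = 0 at h0
    rw [g.symm x (C x)] at h0
    linarith
  have hexp : ∀ b : E i, bracketTerm g lam x b b + bracketTerm g lam x b v +
      (bracketTerm g lam x v b + bracketTerm g lam x v v) =
      (g.inner x (tangentSingle x i b) (C x) + g.inner x (tangentSingle x j v) (C x)) *
      (g.inner x (tangentSingle x i b) (tangentSingle x i b) +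
        g.inner x (tangentSingle x j v) (tangentSingle x j v)) := by
    intro b
    rw [← bracketForm_single_add_single lam x hij, h]
    change g.inner x (tangentSingle x i b + tangentSingle x j v) (C x) *
      g.inner x (tangentSingle x i b + tangentSingle x j v)
        (tangentSingle x i b + tangentSingle x j v) = _
    simp only [map_add, add_apply, hg x i j hij, hg x j i hij.symm]
    ring
  have h1 := hexp a
  -- Subtracting this from the equation for `a` keeps the terms odd in `a`; removing the pure cubic
  -- term by `hdiag` isolates the mixed one.
  have h2 := hexp (-a)
  simp only [bracketTerm_neg_left, bracketTerm_neg_right, map_neg, neg_apply, neg_neg] at h2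
  have h3 := hdiag a
  rw [← hlin] at h1 h2 h3
  have h4 : bracketTerm g lam x a v = mvfderiv (piModel E) (lam i) x (tangentSingle x i a) *
      g.inner x (tangentSingle x j v) (tangentSingle x j v) := by linarith
  rw [bracketTerm] at h4
  linarith

variable [∀ i, FiniteDimensional ℝ (E i)]

/-- The vector field `∑ (∇ λ_i)^i`. -/
def blockGradient (g : PseudoRiemannianMetric (piModel E) (∀ i, M i)) (lam : ι → (∀ i, M i) → ℝ)
    (x : ∀ i, M i) : TangentSpace (piModel E) x :=
  ∑ i, tangentSingle x i (tangentProj x i (g.grad (lam i) x))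

theorem contMDiff_blockGradient {lam : ι → (∀ i, M i) → ℝ}
    (hlam : ∀ i, ContMDiff (piModel E) 𝓘(ℝ, ℝ) ∞ (lam i)) :
    ContMDiff (piModel E) (piModel E).tangent ∞
      (fun x ↦ (⟨x, blockGradient g lam x⟩ : TangentBundle (piModel E) (∀ i, M i))) := by
  intro x
  rw [contMDiffAt_vectorField_iff]
  have h1 : ContMDiffAt (piModel E) 𝓘(ℝ, ∀ i, E i) ∞
      (fun y ↦ ∑ i, modelProj E i (g.gradCoord (lam i) x y)) x :=
    contMDiffAt_finsetSum fun i _ ↦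
      (modelProj E i).contMDiff.contMDiffAt.comp x (g.contMDiffAt_gradCoord (hlam i x))
  refine h1.congr_of_eventuallyEq ?_
  filter_upwards [(chartAt (ModelPi E) x).open_source.mem_nhds (mem_chart_source _ x)] with y hy
  rw [blockGradient, map_sum]
  refine Finset.sum_congr rfl fun i _ ↦ ?_
  have h2 := chartFrame_modelProj hy i (g.gradCoord (lam i) x y)
  rw [PseudoRiemannianMetric.gradCoord, chartFrame_chartCoframe hy] at h2
  rw [← h2, chartCoframe_chartFrame hy]
  rfl

/-- Every term, diagonal ones included, becomes `dλ_i(X_i) g_j(X_j, X_j)`, so the double sum is a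
product of two sums. -/
theorem bracketForm_eq_of_blockScaling (hg : g.IsBlockDiagonal) {lam : ι → (∀ i, M i) → ℝ}
    (h : BlockScaling g lam) (x : ∀ i, M i) (X : ∀ i, E i) :
    bracketForm g lam x X = g.inner x X (blockGradient g lam x) * g.inner x X X := by
  have h1 : ∀ i j, bracketTerm g lam x (X i) (X j) =
      mvfderiv (piModel E) (lam i) x (tangentSingle x i (X i)) *
        g.inner x (tangentSingle x j (X j)) (tangentSingle x j (X j)) := by
    intro i j
    rw [bracketTerm]
    by_cases hij : i = j
    · subst hij
      ring
    · rw [h x i j hij]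
      ring
  have h2 : g.inner x X (blockGradient g lam x) =
      ∑ i, mvfderiv (piModel E) (lam i) x (tangentSingle x i (X i)) := by
    rw [blockGradient, map_sum]
    refine Finset.sum_congr rfl fun i _ ↦ ?_
    rw [← g.inner_grad, g.symm x (g.grad (lam i) x)]
    exact (hg.inner_tangentSingle_right x i _ X).trans
      (hg.inner_tangentSingle_left x i (X i) _).symm
  rw [bracketForm_eq_sum, h2, hg.inner_eq_sum x X X, Finset.sum_mul_sum]
  exact Finset.sum_congr rfl fun i _ ↦ Finset.sum_congr rfl fun j _ ↦ h1 i j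

theorem isConformalKilling_iff_blockScaling [Nonempty (∀ i, M i)]
    {T : (x : ∀ i, M i) → TangentSpace (piModel E) x →L[ℝ] TangentSpace (piModel E) x}
    (hT : IsOrthogonalTensor g T)
    {lam : ι → (∀ i, M i) → ℝ} (hadapted : IsAdaptedToEigenspaces T lam) :
    IsConformalKilling g T ↔ BlockScaling g lam := by
  have hg := hadapted.isBlockDiagonal hT
  have := hadapted.nontrivial
  rw [isConformalKilling_iff hT hadapted]
  constructor
  · rintro ⟨C, -, hC⟩
    exact blockScaling_of_bracketForm_eq hg hC
  · intro h
    exact ⟨blockGradient g lam, contMDiff_blockGradient fun i ↦ hadapted.contMDiff_lam hT i,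
      bracketForm_eq_of_blockScaling hg h⟩

end KillingEquation

/-! ### Functions with vanishing differential, and logarithmic derivatives. -/

section Constancy

variable {E : Type*} [NormedAddCommGroup E] [NormedSpace ℝ E]
  {H : Type*} [TopologicalSpace H] {I : ModelWithCorners ℝ E H} [I.Boundaryless]
  {M : Type*} [TopologicalSpace M] [ChartedSpace H M] [IsManifold I ∞ M]

theorem apply_eq_of_mvfderiv_eq_zero [PreconnectedSpace M] {f : M → ℝ}
    (hf : MDifferentiable I 𝓘(ℝ, ℝ) f) (h : ∀ x, mvfderiv I f x = 0) (x y : M) : f x = f y := by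
  have hloc : IsLocallyConstant f := by
    rw [IsLocallyConstant.iff_eventually_eq]
    intro x
    obtain ⟨r, hr, hball⟩ := Metric.mem_nhds_iff.1 (extChartAt_target_mem_nhds (I := I) x)
    have hd : ∀ z ∈ Metric.ball (extChartAt I x x) r,
        HasFDerivAt (f ∘ (extChartAt I x).symm) (0 : E →L[ℝ] ℝ) z := by
      intro z hz
      have hz' := hball hz
      have h1 : MDifferentiableAt 𝓘(ℝ, E) I (extChartAt I x).symm z := by
        have := mdifferentiableWithinAt_extChartAt_symm (I := I) hz'
        rwa [I.range_eq_univ, mdifferentiableWithinAt_univ] at this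
      have h2 : DifferentiableAt ℝ (f ∘ (extChartAt I x).symm) z :=
        mdifferentiableAt_iff_differentiableAt.1 ((hf _).comp z h1)
      have hs : (extChartAt I x).symm z ∈ (chartAt H x).source := by
        simpa using (extChartAt I x).map_target hz'
      have h3 : fderiv ℝ (f ∘ (extChartAt I x).symm) z = 0 := by
        ext v
        have h4 := mvfderiv_chartFrame hs (hf _) v
        rw [(extChartAt I x).right_inv hz', h] at h4
        exact h4.symm
      exact h3 ▸ h2.hasFDerivAt
    have hconst : ∀ z ∈ Metric.ball (extChartAt I x x) r,
        (f ∘ (extChartAt I x).symm) z = (f ∘ (extChartAt I x).symm) (extChartAt I x x) := by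
      intro z hz
      refine (convex_ball _ _).is_const_of_fderivWithin_eq_zero (𝕜 := ℝ)
        (fun z hz ↦ (hd z hz).differentiableAt.differentiableWithinAt) (fun z hz ↦ ?_) hz
        (Metric.mem_ball_self hr)
      rw [fderivWithin_of_isOpen Metric.isOpen_ball hz, (hd z hz).fderiv]
    filter_upwards [extChartAt_source_mem_nhds (I := I) x,
      (continuousAt_extChartAt (I := I) x).preimage_mem_nhds (Metric.ball_mem_nhds _ hr)]
      with y hy hy'
    have := hconst _ hy'
    simp only [Function.comp_apply] at this
    rwa [(extChartAt I x).left_inv hy, extChartAt_to_inv] at this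
  exact hloc.apply_eq_of_preconnectedSpace x y

theorem mvfderiv_log {f : M → ℝ} {x : M} (hf : ContMDiffAt I 𝓘(ℝ, ℝ) ∞ f x) (h0 : f x ≠ 0)
    (v : TangentSpace I x) :
    mvfderiv I (fun y ↦ Real.log (f y)) x v = mvfderiv I f x v / f x := by
  have h0' : (f ∘ (extChartAt I x).symm) (extChartAt I x x) ≠ 0 := by
    rwa [Function.comp_apply, extChartAt_to_inv]
  have h1 := (hasFDerivAt_comp_extChartAt_symm hf).log h0'
  refine ((hasMVFDeriv_of_comp_symm (f := fun y ↦ Real.log (f y)) h1).2 v).trans ?_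
  rw [Function.comp_apply, extChartAt_to_inv, div_eq_inv_mul]
  rfl

end Constancy

/-! ### Twist functions and integration of the scaling law along one factor. -/

section Twisted

variable {ι : Type*} [Fintype ι] [DecidableEq ι] {E : ι → Type*} [∀ i, NormedAddCommGroup (E i)]
  [∀ i, NormedSpace ℝ (E i)]
  {M : ι → Type*} [∀ i, TopologicalSpace (M i)]
  [∀ i, ChartedSpace (E i) (M i)] [∀ i, IsManifold 𝓘(ℝ, E i) ∞ (M i)]
  {g : PseudoRiemannianMetric (piModel E) (∀ i, M i)}

theorem PseudoRiemannianMetric.inner_tangentSingle_congr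
    (g : PseudoRiemannianMetric (piModel E) (∀ i, M i)) {x y : ∀ i, M i} (h : x = y) (j : ι)
    (v : E j) : g.inner x (tangentSingle x j v) (tangentSingle x j v) =
      g.inner y (tangentSingle y j v) (tangentSingle y j v) := by
  subst h
  rfl

theorem IsTwistedProductMetric.inner_tangentSingle
    {gf : (i : ι) → PseudoRiemannianMetric 𝓘(ℝ, E i) (M i)} {ρ : ι → (∀ i, M i) → ℝ}
    (h : IsTwistedProductMetric g gf ρ) (x : ∀ i, M i) (j : ι) (v w : E j) :
    g.inner x (tangentSingle x j v) (tangentSingle x j w) =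
      ρ j x ^ 2 * (gf j).inner (x j) v w := by
  rw [h.inner_eq]
  simp only [mfderiv_apply_pi]
  rw [Finset.sum_eq_single j]
  · rw [tangentProj_tangentSingle_self, tangentProj_tangentSingle_self]
  · intro k _ hk
    rw [tangentProj_tangentSingle_of_ne x hk]
    exact mul_eq_zero_of_right _ (congrArg (fun L : E k →L[ℝ] ℝ ↦ L _) (map_zero _))
  · simp

/-- Along the `i`-th factor the point of `M_j` is fixed, so only `ρ_j²` varies. -/
theorem IsTwistedProductMetric.coordDeriv_eq
    {gf : (i : ι) → PseudoRiemannianMetric 𝓘(ℝ, E i) (M i)} {ρ : ι → (∀ i, M i) → ℝ}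
    (h : IsTwistedProductMetric g gf ρ) (x : ∀ i, M i) {i j : ι} (hij : i ≠ j) (a : E i)
    (v : E j) :
    g.coordDeriv x (Pi.single i a) (Pi.single j v) (Pi.single j v) =
      2 * mvfderiv (piModel E) (fun y ↦ Real.log (ρ j y)) x (tangentSingle x i a) *
        g.inner x (tangentSingle x j v) (tangentSingle x j v) := by
  rw [← (g.mvfderiv_inner_update x hij v v).2 a]
  have hfun : (fun y ↦ g.inner (Function.update x i y) (tangentSingle _ j v)
      (tangentSingle _ j v)) =
      fun y ↦ (fun y' ↦ ρ j y' ^ 2 * (gf j).inner (x j) v v) (Function.update x i y) := by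
    ext y
    rw [h.inner_tangentSingle]
    have hz : ∀ z, z = x j → (gf j).inner z v v = (gf j).inner (x j) v v := by
      rintro _ rfl
      rfl
    exact congrArg _ (hz _ (Function.update_of_ne hij.symm _ _))
  have hρ := hasFDerivAt_comp_extChartAt_symm (h.contMDiff j x)
  have hd := hasMVFDeriv_of_comp_symm (f := fun y' ↦ ρ j y' ^ 2 * (gf j).inner (x j) v v)
    ((hρ.pow 2).mul_const ((gf j).inner (x j) v v))
  rw [hfun]
  refine ((mvfderiv_comp_update i hd.1).2 a).trans ((hd.2 _).trans ?_)
  have hpos := (h.pos j x).ne'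
  rw [mvfderiv_log (h.contMDiff j x) hpos, h.inner_tangentSingle]
  have hto : (extChartAt (piModel E) x).symm (extChartAt (piModel E) x x) = x :=
    extChartAt_to_inv x
  simp only [Function.comp_apply, hto]
  change _ * (_ * mvfderiv (piModel E) (ρ j) x (tangentSingle x i a)) = _
  field_simp
  simp only [Nat.add_one_sub_one, pow_one, nsmul_eq_mul, Nat.cast_ofNat]
  ring

/-- For a twisted product, the scaling of the blocks is a condition on the twist functions. -/
theorem IsTwistedProductMetric.blockScaling_iff [∀ i, Nontrivial (E i)] (hg : g.IsBlockDiagonal)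
    {gf : (i : ι) → PseudoRiemannianMetric 𝓘(ℝ, E i) (M i)} {ρ : ι → (∀ i, M i) → ℝ}
    (h : IsTwistedProductMetric g gf ρ) {lam : ι → (∀ i, M i) → ℝ}
    (hlam : ∀ i, ContMDiff (piModel E) 𝓘(ℝ, ℝ) ∞ (lam i))
    (hne : ∀ x i j, i ≠ j → lam i x ≠ lam j x) :
    BlockScaling g lam ↔ ∀ i x j, j ≠ i → ∀ v : E j,
      mvfderiv (piModel E) (fun y ↦ Real.log (ρ i y)) x (tangentSingle x j v) =
        1 / 2 * mvfderiv (piModel E) (fun y ↦ Real.log |lam i y - lam j y|) x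
          (tangentSingle x j v) := by
  -- The logarithmic derivative with denominators cleared; `Real.log` ignores signs, so the absolute
  -- value plays no role.
  have key : ∀ (x : ∀ i, M i) (i j : ι), j ≠ i → ∀ a : E j,
      mvfderiv (piModel E) (fun y ↦ Real.log |lam i y - lam j y|) x (tangentSingle x j a) *
        (lam j x - lam i x) =
      mvfderiv (piModel E) (lam j) x (tangentSingle x j a) -
        mvfderiv (piModel E) (lam i) x (tangentSingle x j a) := by
    intro x i j hij a
    simp_rw [Real.log_abs]
    have hs : lam i x - lam j x ≠ 0 := sub_ne_zero.2 (hne x i j hij.symm)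
    rw [mvfderiv_log ((hlam i x).sub (hlam j x)) hs,
      mvfderiv_fun_sub ((hlam i x).mdifferentiableAt (by simp))
        ((hlam j x).mdifferentiableAt (by simp)), sub_apply]
    field_simp
    ring
  constructor
  · intro hs i x j hij a
    obtain ⟨v, hv⟩ := hg.exists_inner_self_ne_zero (i := i) x
    have h1 := hs x j i hij a v
    rw [h.coordDeriv_eq x hij, ← key x i j hij a] at h1
    have hs : lam j x - lam i x ≠ 0 := sub_ne_zero.2 (hne x j i hij)
    refine mul_right_cancel₀ (mul_ne_zero hs hv) ?_
    linear_combination (1 / 2) * h1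
  · intro hc x i j hij a v
    rw [h.coordDeriv_eq x hij, hc j x i hij, ← key x j i hij a]
    ring

/-- Along the `i`-th factor, the `j`-th block of the metric is proportional to `λ_i - λ_j`. -/
theorem BlockScaling.inner_update {lam : ι → (∀ i, M i) → ℝ} (h : BlockScaling g lam)
    (hlam : ∀ i, ContMDiff (piModel E) 𝓘(ℝ, ℝ) ∞ (lam i))
    (hne : ∀ x i j, i ≠ j → lam i x ≠ lam j x) (x : ∀ i, M i) {i j : ι} (hij : i ≠ j)
    [PreconnectedSpace (M i)] (z : M i) (v : E j) :
    g.inner x (tangentSingle x j v) (tangentSingle x j v) =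
      (lam i x - lam j x) / (lam i (Function.update x i z) - lam j (Function.update x i z)) *
        g.inner (Function.update x i z) (tangentSingle _ j v) (tangentSingle _ j v) := by
  have hne' : ∀ y, lam i y - lam j y ≠ 0 := fun y ↦ sub_ne_zero.2 (hne y i j hij)
  let F : M i → ℝ := fun y ↦
    g.inner (Function.update x i y) (tangentSingle _ j v) (tangentSingle _ j v)
  let D : M i → ℝ := fun y ↦ lam i (Function.update x i y) - lam j (Function.update x i y)
  have hFy : ∀ y, MDifferentiableAt 𝓘(ℝ, E i) 𝓘(ℝ, ℝ) F y ∧ ∀ a : E i,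
      D y * mvfderiv 𝓘(ℝ, E i) F y a = mvfderiv 𝓘(ℝ, E i) D y a * F y := by
    intro y
    -- The scaling law concerns derivatives at the base point of the slice, so `x` is replaced by
    -- the point of the same slice whose `i`-th coordinate is `y`.
    have aux : ∀ x' : ∀ i, M i, x' i = y → (∀ z, Function.update x' i z = Function.update x i z) →
        MDifferentiableAt 𝓘(ℝ, E i) 𝓘(ℝ, ℝ) F y ∧ ∀ a : E i,
          D y * mvfderiv 𝓘(ℝ, E i) F y a = mvfderiv 𝓘(ℝ, E i) D y a * F y := by
      rintro x' rfl hx'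
      have hF : F = fun z ↦ g.inner (Function.update x' i z) (tangentSingle _ j v)
          (tangentSingle _ j v) := funext fun z ↦ g.inner_tangentSingle_congr (hx' z).symm j v
      have hD : D = fun z ↦ lam i (Function.update x' i z) - lam j (Function.update x' i z) :=
        funext fun z ↦ by simp only [D, hx']
      have h1 := g.mvfderiv_inner_update x' hij v v
      have hl := fun k ↦ mvfderiv_comp_update i ((hlam k x').mdifferentiableAt (by simp))
      have hself : Function.update x' i (x' i) = x' := Function.update_eq_self i x'
      have hFx : F (x' i) = g.inner x' (tangentSingle x' j v) (tangentSingle x' j v) := by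
        rw [hF]
        exact g.inner_tangentSingle_congr hself j v
      have hDx : D (x' i) = lam i x' - lam j x' := by simp only [hD, hself]
      refine ⟨hF ▸ h1.1, fun a ↦ ?_⟩
      have hDa : mvfderiv 𝓘(ℝ, E i) D (x' i) a =
          mvfderiv (piModel E) (lam i) x' (tangentSingle _ i a) -
          mvfderiv (piModel E) (lam j) x' (tangentSingle _ i a) := by
        have e := mvfderiv_fun_sub (hl i).1 (hl j).1
        rw [hD]
        refine (congrArg (fun L : E i →L[ℝ] ℝ ↦ L a) e).trans ?_
        exact congrArg₂ (· - ·) ((hl i).2 a) ((hl j).2 a)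
      have hFa : mvfderiv 𝓘(ℝ, E i) F (x' i) a =
          g.coordDeriv x' (Pi.single i a) (Pi.single j v) (Pi.single j v) := by
        rw [hF]
        exact h1.2 a
      rw [hDa, hFa, hFx, hDx]
      exact h x' i j hij a v
    exact aux (Function.update x i y) (Function.update_self _ _ _)
      fun z ↦ Function.update_idem _ _ _
  have hDd : ∀ y, MDifferentiableAt 𝓘(ℝ, E i) 𝓘(ℝ, ℝ) D y := fun y ↦
    (((hlam i).sub (hlam j)).comp (contMDiff_update x i)).mdifferentiableAt (by simp)
  have hDs : ∀ y, ContMDiffAt 𝓘(ℝ, E i) 𝓘(ℝ, ℝ) ∞ D y := fun y ↦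
    (((hlam i).sub (hlam j)).comp (contMDiff_update x i)) y
  have hinv : ∀ y, ContMDiffAt 𝓘(ℝ, E i) 𝓘(ℝ, ℝ) ∞ (fun y ↦ (D y)⁻¹) y := fun y ↦
    (hDs y).inv₀ (hne' _)
  have hq : ∀ y, MDifferentiableAt 𝓘(ℝ, E i) 𝓘(ℝ, ℝ) (fun y ↦ F y * (D y)⁻¹) y := fun y ↦
    (hFy y).1.mul ((hinv y).mdifferentiableAt (by simp))
  -- The product rule for `F = (F / D) · D`, compared with `D F' = D' F`, leaves `D² (F / D)' = 0`.
  have hzero : ∀ y, mvfderiv 𝓘(ℝ, E i) (fun y ↦ F y * (D y)⁻¹) y = 0 := by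
    intro y
    have hprod : (fun y ↦ (F y * (D y)⁻¹) * D y) = F := by
      ext y
      exact inv_mul_cancel_right₀ (hne' _) _
    have e1 := mvfderiv_fun_mul (hq y) (hDd y)
    rw [hprod] at e1
    ext a
    have e2 := congrArg (fun L : TangentSpace 𝓘(ℝ, E i) y →L[ℝ] ℝ ↦ L a) e1
    simp only [add_apply, smul_apply, smul_eq_mul] at e2
    have e3 := (hFy y).2 a
    have hD0 : D y ≠ 0 := hne' _
    have e4 : D y * (D y * mvfderiv 𝓘(ℝ, E i) (fun y ↦ F y * (D y)⁻¹) y a) = 0 := by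
      have : D y * (F y * (D y)⁻¹ * mvfderiv 𝓘(ℝ, E i) D y a) =
          mvfderiv 𝓘(ℝ, E i) D y a * F y := by
        field_simp
      linear_combination (-(D y)) * e2 + e3 - this
    simpa [hD0] using e4
  have hc := apply_eq_of_mvfderiv_eq_zero hq hzero (x i) z
  have hx : Function.update x i (x i) = x := Function.update_eq_self i x
  have hFx : F (x i) = g.inner x (tangentSingle x j v) (tangentSingle x j v) :=
    g.inner_tangentSingle_congr hx j v
  have hDx : D (x i) = lam i x - lam j x := by simp only [D, hx]
  simp only [hFx, hDx] at hc
  have h1 := hne' x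
  have h2 := hne' (Function.update x i z)
  change _ = (lam i x - lam j x) / D z * F z
  have h2' : D z ≠ 0 := h2
  field_simp at hc ⊢
  linarith

end Twisted

/-! ### Construction of the factor metrics and twist functions. -/

section Construction

/-- By the intermediate value theorem `f` has constant sign. This makes the scaling factors
positive, so that their square roots are smooth. -/
theorem div_pos_of_connected {X : Type*} [TopologicalSpace X] [PreconnectedSpace X] {f : X → ℝ}
    (hf : Continuous f) (h0 : ∀ x, f x ≠ 0) (x y : X) : 0 < f x / f y := by
  rcases lt_or_gt_of_ne (h0 x) with hx | hx <;> rcases lt_or_gt_of_ne (h0 y) with hy | hy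
  · exact div_pos_of_neg_of_neg hx hy
  · obtain ⟨z, hz⟩ := mem_range_of_exists_le_of_exists_ge hf ⟨x, hx.le⟩ ⟨y, hy.le⟩
    exact absurd hz (h0 z)
  · obtain ⟨z, hz⟩ := mem_range_of_exists_le_of_exists_ge hf ⟨y, hy.le⟩ ⟨x, hx.le⟩
    exact absurd hz (h0 z)
  · exact div_pos hx hy

variable {ι : Type*} [Fintype ι] [DecidableEq ι] {E : ι → Type*} [∀ i, NormedAddCommGroup (E i)]
  [∀ i, NormedSpace ℝ (E i)]
  {M : ι → Type*} [∀ i, TopologicalSpace (M i)]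
  [∀ i, ChartedSpace (E i) (M i)]

theorem contMDiff_piecewise (x₀ : ∀ i, M i) (S : Finset ι) :
    ContMDiff (piModel E) (piModel E) ∞ (fun x : ∀ i, M i ↦ S.piecewise x₀ x) := by
  rw [contMDiff_pi_iff]
  intro j
  by_cases h : j ∈ S
  · simpa [h] using contMDiff_const
  · simpa [h] using contMDiff_apply_pi j

variable [∀ i, IsManifold 𝓘(ℝ, E i) ∞ (M i)]
  {g : PseudoRiemannianMetric (piModel E) (∀ i, M i)}

/-- The restriction of a metric on the product to the slice of the `j`-th factor through `x₀`. -/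
def PseudoRiemannianMetric.sliceInner (g : PseudoRiemannianMetric (piModel E) (∀ i, M i))
    (x₀ : ∀ i, M i) (j : ι) (z : M j) :
    TangentSpace 𝓘(ℝ, E j) z →L[ℝ] TangentSpace 𝓘(ℝ, E j) z →L[ℝ] ℝ :=
  (show E j →L[ℝ] E j →L[ℝ] ℝ from
    (show (∀ i, E i) →L[ℝ] (∀ i, E i) →L[ℝ] ℝ from g.inner (Function.update x₀ j z)).bilinearComp
      (ContinuousLinearMap.single ℝ E j) (ContinuousLinearMap.single ℝ E j))

/-- The metric induced by a block diagonal metric on the slice of the `j`-th factor through `x₀`. -/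
def PseudoRiemannianMetric.IsBlockDiagonal.slice (hg : g.IsBlockDiagonal) (x₀ : ∀ i, M i) (j : ι) :
    PseudoRiemannianMetric 𝓘(ℝ, E j) (M j) where
  inner := g.sliceInner x₀ j
  symm z v w := g.symm (Function.update x₀ j z) (tangentSingle _ j v) (tangentSingle _ j w)
  nondegenerate z v h := hg.nondegenerate_block (Function.update x₀ j z) j v h
  contMDiff := by
    intro z₀
    refine contMDiffAt_bilin_iff.2 ?_
    let s := ContinuousLinearMap.single ℝ E j
    -- Restriction of covectors to the `j`-th factor; with `s` in the first slot it cuts out the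
    -- `j`-th block of the coordinate metric.
    let P : ((∀ i, E i) →L[ℝ] ℝ) →L[ℝ] E j →L[ℝ] ℝ :=
      (ContinuousLinearMap.compL ℝ (E j) (∀ i, E i) ℝ).flip s
    have h1 : ContMDiffAt 𝓘(ℝ, E j) 𝓘(ℝ, (∀ i, E i) →L[ℝ] (∀ i, E i) →L[ℝ] ℝ) ∞
        (fun z ↦ g.coord (Function.update x₀ j z₀) (Function.update x₀ j z)) z₀ :=
      (g.contMDiffAt_coord (Function.update x₀ j z₀)).comp z₀ (contMDiff_update x₀ j z₀)
    have h2 := (contMDiffAt_const (c := P)).clm_comp (h1.clm_comp (contMDiffAt_const (c := s)))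
    refine h2.congr_of_eventuallyEq ?_
    filter_upwards [(chartAt (E j) z₀).open_source.mem_nhds (mem_chart_source _ z₀)] with z hz
    have hs : Function.update x₀ j z ∈
        (chartAt (ModelPi E) (Function.update x₀ j z₀)).source := by
      rw [piChartedSpace_chartAt]
      intro k _
      by_cases hk : k = j
      · subst hk; simpa using hz
      · simp [Function.update_of_ne hk]
    have key : ∀ u : E j, chartFrame (piModel E) (Function.update x₀ j z₀)
        (Function.update x₀ j z) (Pi.single j u) =
        tangentSingle (Function.update x₀ j z) j (chartFrame 𝓘(ℝ, E j) z₀ z u) := by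
      intro u
      rw [chartFrame_single hs]
      congr 1
      rw [Function.update_self, Function.update_self]
    ext v w
    change _ = g.coord (Function.update x₀ j z₀) (Function.update x₀ j z)
      (Pi.single j v) (Pi.single j w)
    rw [g.coord_apply, key, key]
    rfl

theorem PseudoRiemannianMetric.IsBlockDiagonal.slice_inner (hg : g.IsBlockDiagonal)
    (x₀ : ∀ i, M i) (j : ι) (z : M j) (v w : E j) :
    (hg.slice x₀ j).inner z v w =
      g.inner (Function.update x₀ j z) (tangentSingle _ j v) (tangentSingle _ j w) := rfl

/-- Coordinates in `S` are frozen at `x₀` one at a time; each contributes the factor from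
`BlockScaling.inner_update`. -/
theorem BlockScaling.exists_scale {lam : ι → (∀ i, M i) → ℝ} (h : BlockScaling g lam)
    (hlam : ∀ i, ContMDiff (piModel E) 𝓘(ℝ, ℝ) ∞ (lam i))
    (hne : ∀ x i j, i ≠ j → lam i x ≠ lam j x) [PreconnectedSpace (∀ i, M i)]
    (hconn : ∀ i, PreconnectedSpace (M i)) (x₀ : ∀ i, M i) (j : ι) (S : Finset ι) (hS : j ∉ S) :
    ∃ σ : (∀ i, M i) → ℝ, ContMDiff (piModel E) 𝓘(ℝ, ℝ) ∞ σ ∧ (∀ x, 0 < σ x) ∧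
      ∀ x (v : E j), g.inner x (tangentSingle x j v) (tangentSingle x j v) =
        σ x * g.inner (S.piecewise x₀ x) (tangentSingle _ j v) (tangentSingle _ j v) := by
  induction S using Finset.induction_on with
  | empty =>
    refine ⟨fun _ ↦ 1, contMDiff_const, fun _ ↦ one_pos, fun x v ↦ ?_⟩
    rw [one_mul]
    exact g.inner_tangentSingle_congr (Finset.piecewise_empty x₀ x).symm j v
  | insert i S hi ih =>
    have hij : i ≠ j := fun hij ↦ hS (by simp [hij])
    obtain ⟨σ, hσ, hpos, heq⟩ := ih fun hj ↦ hS (Finset.mem_insert_of_mem hj)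
    have hD : ContMDiff (piModel E) 𝓘(ℝ, ℝ) ∞ (fun x ↦ lam i x - lam j x) :=
      (hlam i).sub (hlam j)
    have hne' : ∀ y, lam i y - lam j y ≠ 0 := fun y ↦ sub_ne_zero.2 (hne y i j hij)
    let r : (∀ i, M i) → ℝ := fun x ↦ (lam i x - lam j x) /
      (lam i (Function.update x i (x₀ i)) - lam j (Function.update x i (x₀ i)))
    have hr : ContMDiff (piModel E) 𝓘(ℝ, ℝ) ∞ r :=
      hD.div₀ (hD.comp (contMDiff_update_const i (x₀ i))) fun x ↦ hne' _
    refine ⟨fun x ↦ σ x * r (S.piecewise x₀ x), hσ.mul (hr.comp (contMDiff_piecewise x₀ S)),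
      fun x ↦ mul_pos (hpos x) (div_pos_of_connected hD.continuous hne' _ _), fun x v ↦ ?_⟩
    have := hconn i
    rw [heq, h.inner_update hlam hne (S.piecewise x₀ x) hij (x₀ i) v, mul_assoc]
    refine congrArg (fun t ↦ σ x * (r (S.piecewise x₀ x) * t)) ?_
    exact g.inner_tangentSingle_congr (S.piecewise_insert x₀ x i).symm j v

/-- With every coordinate but the `j`-th frozen, the block at `x` is a multiple of the metric of the
slice through `x₀`, which depends on `x_j` alone. -/
theorem BlockScaling.exists_isTwistedProductMetric (hg : g.IsBlockDiagonal)
    {lam : ι → (∀ i, M i) → ℝ} (h : BlockScaling g lam)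
    (hlam : ∀ i, ContMDiff (piModel E) 𝓘(ℝ, ℝ) ∞ (lam i))
    (hne : ∀ x i j, i ≠ j → lam i x ≠ lam j x) [ConnectedSpace (∀ i, M i)] :
    ∃ (gf : (i : ι) → PseudoRiemannianMetric 𝓘(ℝ, E i) (M i)) (ρ : ι → (∀ i, M i) → ℝ),
      IsTwistedProductMetric g gf ρ := by
  obtain ⟨x₀⟩ := (inferInstance : Nonempty (∀ i, M i))
  have hconn : ∀ i, PreconnectedSpace (M i) := fun i ↦
    (show Function.Surjective (fun x : ∀ i, M i ↦ x i) from
      fun z ↦ ⟨Function.update x₀ i z, by simp⟩).denseRange.preconnectedSpace (continuous_apply i)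
  choose σ hσ hpos heq using fun j ↦
    h.exists_scale hlam hne hconn x₀ j (Finset.univ.erase j) (Finset.notMem_erase j _)
  have heq' : ∀ j x (v : E j), g.inner x (tangentSingle x j v) (tangentSingle x j v) =
      σ j x * (hg.slice x₀ j).inner (x j) v v := by
    intro j x v
    rw [heq, hg.slice_inner]
    refine congrArg _ (g.inner_tangentSingle_congr ?_ j v)
    ext k
    by_cases hk : k = j
    · subst hk; simp
    · simp [hk]
  -- Polarization: the factor `σ j x` does not depend on the vector.
  have hpol : ∀ j x (v w : E j), g.inner x (tangentSingle x j v) (tangentSingle x j w) =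
      σ j x * (hg.slice x₀ j).inner (x j) v w := by
    intro j x v w
    have h1 := heq' j x (v + w)
    rw [hg.slice_inner] at h1 ⊢
    simp only [map_add, add_apply] at h1
    have h2 := heq' j x v
    have h3 := heq' j x w
    rw [hg.slice_inner] at h2 h3
    rw [h2, h3, g.symm x (tangentSingle x j w), g.symm (Function.update x₀ j (x j))
      (tangentSingle _ j w) (tangentSingle _ j v)] at h1
    linarith
  refine ⟨hg.slice x₀, fun j x ↦ Real.sqrt (σ j x), ⟨fun j x ↦ ?_, fun j x ↦ ?_, fun x v w ↦ ?_⟩⟩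
  · exact (Real.contDiffAt_sqrt (hpos j x).ne').contMDiffAt.comp x (hσ j x)
  · exact Real.sqrt_pos.2 (hpos j x)
  · rw [hg.inner_eq_sum]
    refine Finset.sum_congr rfl fun j _ ↦ ?_
    rw [Real.sq_sqrt (hpos j x).le, hpol, mfderiv_apply_pi, mfderiv_apply_pi]

end Construction

end

/-! ### The main theorem. -/

theorem mainTheorem4 {ι : Type*} [Fintype ι] [DecidableEq ι]
    {E : ι → Type*} [∀ i, NormedAddCommGroup (E i)] [∀ i, NormedSpace ℝ (E i)]
    [∀ i, FiniteDimensional ℝ (E i)]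
    {M : ι → Type*} [∀ i, TopologicalSpace (M i)] [∀ i, ChartedSpace (E i) (M i)]
    [∀ i, IsManifold 𝓘(ℝ, E i) ∞ (M i)] [ConnectedSpace (∀ i, M i)]
    (g : PseudoRiemannianMetric (piModel E) (∀ i, M i))
    (T : (x : ∀ i, M i) → TangentSpace (piModel E) x →L[ℝ] TangentSpace (piModel E) x)
    (hT : IsOrthogonalTensor g T)
    (lam : ι → (∀ i, M i) → ℝ) (hadapted : IsAdaptedToEigenspaces T lam) :
    IsConformalKilling g T ↔
      ∃ (gf : (i : ι) → PseudoRiemannianMetric 𝓘(ℝ, E i) (M i)) (ρ : ι → (∀ i, M i) → ℝ),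
        IsTwistedProductMetric g gf ρ ∧
        ∀ (i : ι) (x : ∀ i, M i),
          g.perpProj x (productNet i x) (g.grad (fun y ↦ Real.log (ρ i y)) x) =
            (1 / 2 : ℝ) • ∑ j ∈ Finset.univ.erase i,
              g.orthProj x (productNet j x)
                (g.grad (fun y ↦ Real.log |lam i y - lam j y|) x) := by
  have hg := hadapted.isBlockDiagonal hT
  have := hadapted.nontrivial
  have hlam := hadapted.contMDiff_lam hT
  have hne : ∀ x i j, i ≠ j → lam i x ≠ lam j x := fun x i j hij ↦ hadapted.lam_ne x hij
  rw [isConformalKilling_iff_blockScaling hT hadapted]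
  -- For any twisted product structure the gradient condition is equivalent to the scaling law, so
  -- any such structure can serve as the witness.
  have key : ∀ gf ρ, IsTwistedProductMetric g gf ρ → (BlockScaling g lam ↔ _) :=
    fun gf ρ h ↦ (h.blockScaling_iff hg hlam hne).trans (forall₂_congr fun i x ↦
      (hg.perpProj_grad_eq_iff x i (fun y ↦ Real.log (ρ i y))
        (fun j y ↦ Real.log |lam i y - lam j y|)).symm)
  constructor
  · intro h
    obtain ⟨gf, ρ, hρ⟩ := h.exists_isTwistedProductMetric hg hlam hne
    exact ⟨gf, ρ, hρ, (key gf ρ hρ).1 h⟩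
  · rintro ⟨gf, ρ, hρ, hc⟩
    exact (key gf ρ hρ).2 hc
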